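/- Let $k$ be a field of characteristic $0$ and let $k(\alpha)/k$ be a quadratic extension with $\alpha\notin k$, $\alpha^2\in k$; let $\sigma$ be the non-trivial element of $\mathrm{Gal}(k(\alpha)/k)$. Let $e_1,\dots,e_7$ be the standard basis of $V=k^7$, put $e_{ijl}=e_i\wedge e_j\wedge e_l$, $$\bar w=e_{234}+e_{567}+e_{125}+e_{136}+e_{147}\in\wedge^3V,$$ and let $G\subset\mathrm{GL}(7)$ be the closed $k$-subgroup of all $g$ with $g\bar w=c(g)\bar w$ for some $c(g)\in\mathrm{GL}(1)$. For a $k$-algebra $R$ and $A\in\mathrm{SL}(3)_R$ let $d(A)\in\mathrm{GL}(7)_R$ be the block diagonal matrix with blocks $1$, $A$, ${}^tA^{-1}$. Let $w={}^t(1,0,\dots,0)$, $$g_\alpha=\begin{pmatrix}0&-\alpha&0&0&\alpha&0&0\\ \frac{\alpha^2}2&\frac{\alpha^2}2&0&0&\frac{\alpha^2}2&0&0\\ 0&0&\frac\alpha2&-\frac\alpha2&0&-\frac\alpha2&-\frac\alpha2\\ 0&0&\frac12&\frac12&0&\frac12&-\frac12\\ -\frac12&\frac12&0&0&\frac12&0&0\\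 0&0&-\frac\alpha2&-\frac\alpha2&0&\frac\alpha2&-\frac\alpha2\\ 0&0&\frac{\alpha^2}2&-\frac{\alpha^2}2&0&\frac{\alpha^2}2&\frac{\alpha^2}2\end{pmatrix},$$ and $w_\alpha=g_\alpha w={}^t(0,\frac{\alpha^2}2,0,0,-\frac12,0,0)\in k^7$. Let $G_{w_\alpha}$ be the stabilizer of $w_\alpha$ in $G$ and $G_{w_\alpha}^0$ its connected component of $1$. For a $k$-algebra $R$ put $R(\alpha)=R\otimes_kk(\alpha)$ with $(r\otimes x)^\sigma=r\otimes x^\sigma$, let $\Lambda=\mathrm{diag}(1,1,-1)$, and for a matrix $A$ over $R(\alpha)$ put ${}^*A={}^t(A^\sigma)$ ($\sigma$ acting entry-wise). Let $\mathrm{SU}_\alpha(2,1)$ be the $k$-group with $$\mathrm{SU}_\alpha(2,1)_R=\{A\in\mathrm{SL}(3)_{R(\alpha)}\mid A\,\Lambda\,{}^*A=\Lambda\}.$$ Then for every $k$-algebra $R$, inside $\mathrm{GL}(7)_{R(\alpha)}$, $$G^0_{w_\alpha R}=\{g_\alpha d(A)g_\alpha^{-1}\mid A\in\mathrm{SU}_\alpha(2,1)_R\},$$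 and $A\mapsto g_\alpha d(A)g_\alpha^{-1}$ is a group isomorphism $\mathrm{SU}_\alpha(2,1)_R\to G^0_{w_\alpha R}$, natural in $R$. In particular $G^0_{w_\alpha}\cong\mathrm{SU}_\alpha(2,1)$ as $k$-groups. -/

import Mathlib

open scoped TensorProduct Matrix MatrixGroups IntermediateField

universe u

noncomputable section

namespace G2Prehomogeneous


/-! ### Affine `k`-groups given as subgroup functors of `GL(n)`, and their identity component

A closed `k`-subgroup of `GL(n)` is described by its functor of points `R ↦ H R ≤ GL(n, R)`,
with `R` running over the commutative `k`-algebras. -/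

section IdentityComponent

variable {k : Type u} [Field k] {n : ℕ}

/-- The affine space of `n × n` matrices over `k`, as a topological space (Zariski topology). -/
abbrev MatrixSpace (k : Type u) [Field k] (n : ℕ) : Type u :=
  PrimeSpectrum (MvPolynomial (Fin n × Fin n) k)

/-- The underlying map `Spec R → MatrixSpace k n` of the morphism given by an `R`-valued matrix. -/
def pointMap {R : Type u} [CommRing R] [Algebra k R] (g : Matrix (Fin n) (Fin n) R) :
    PrimeSpectrum R → MatrixSpace k n :=
  PrimeSpectrum.comap
    (MvPolynomial.aeval (fun ij : Fin n × Fin n => g ij.1 ij.2) :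
      MvPolynomial (Fin n × Fin n) k →ₐ[k] R).toRingHom

/-- The matrix over the residue field of a point `p` of the space of matrices
which that point represents. -/
def matrixAt (p : MatrixSpace k n) : Matrix (Fin n) (Fin n) p.asIdeal.ResidueField :=
  (Matrix.mvPolynomialX (Fin n) (Fin n) k).map
    (algebraMap (MvPolynomial (Fin n × Fin n) k) p.asIdeal.ResidueField)

/-- The underlying set of the scheme `H`, inside the space of matrices: the points `p` such that
the matrix at `p` belongs to `H` over the residue field of `p`. It carries the subspace
(Zariski) topology. -/
def underlyingSpace
    (H : ∀ (R : Type u) [CommRing R] [Algebra k R], Subgroup (GL (Fin n) R)) :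
    Set (MatrixSpace k n) :=
  {p | ∃ g ∈ H p.asIdeal.ResidueField,
    (g : Matrix (Fin n) (Fin n) p.asIdeal.ResidueField) = matrixAt p}

/-- The identity element, as a (`k`-rational) point of the space of matrices. -/
def identityPoint (k : Type u) [Field k] (n : ℕ) : MatrixSpace k n :=
  pointMap (R := k) 1 ⊥

/-- The `R`-valued points of the identity component `H⁰` of `H`: the `R`-valued points of `H` for
which `Spec R → H` takes its values in the connected component of `1` in the space of `H`.
(The connected component of `1` is an open and closed subscheme, so these are the `R`-valued
points of this subscheme.) -/
def identityComponent
    (H : ∀ (R : Type u) [CommRing R] [Algebra k R], Subgroup (GL (Fin n) R))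
    (R : Type u) [CommRing R] [Algebra k R] : Set (GL (Fin n) R) :=
  {g | g ∈ H R ∧ ∀ q : PrimeSpectrum R,
    pointMap (k := k) (g : Matrix (Fin n) (Fin n) R) q ∈
      connectedComponentIn (underlyingSpace H) (identityPoint k n)}

end IdentityComponent

/-! ### The group `G` and stabilizers

Indices are shifted by one: the basis vector `e_i` (`1 ≤ i ≤ 7`) is `e R (i - 1)`. -/

section Group

/-- The standard basis of `W = R⁷`. -/
def e (R : Type u) [CommRing R] (i : Fin 7) : Fin 7 → R := Pi.single i 1

/-- `e_i ∧ e_j ∧ e_l` in `⋀³ W`. -/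
def e3 (R : Type u) [CommRing R] (i j l : Fin 7) : ⋀[R]^3 (Fin 7 → R) :=
  exteriorPower.ιMulti R 3 ![e R i, e R j, e R l]

/-- The form `e₂₃₄ + e₅₆₇ + e₁ ∧ (e₂₅ + e₃₆ + e₄₇)`. -/
def wBar (R : Type u) [CommRing R] : ⋀[R]^3 (Fin 7 → R) :=
  e3 R 1 2 3 + e3 R 4 5 6 + (e3 R 0 1 4 + e3 R 0 2 5 + e3 R 0 3 6)

/-- The natural action of a matrix on `⋀³ W`. -/
def act3 {R : Type u} [CommRing R] (g : Matrix (Fin 7) (Fin 7) R) :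
    ⋀[R]^3 (Fin 7 → R) →ₗ[R] ⋀[R]^3 (Fin 7 → R) :=
  exteriorPower.map 3 (Matrix.toLin' g)

theorem act3_one {R : Type u} [CommRing R] (x : ⋀[R]^3 (Fin 7 → R)) :
    act3 (1 : Matrix (Fin 7) (Fin 7) R) x = x := by
  simp [act3, Matrix.toLin'_one]

theorem act3_mul {R : Type u} [CommRing R] (g h : Matrix (Fin 7) (Fin 7) R)
    (x : ⋀[R]^3 (Fin 7 → R)) : act3 (g * h) x = act3 g (act3 h x) := by
  rw [act3, act3, act3, Matrix.toLin'_mul, ← LinearMap.comp_apply, exteriorPower.map_comp]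

/-- The `R`-valued points of the group `G`: those `g ∈ GL(7, R)` with `g w̄ = c w̄` for some
`c ∈ GL(1, R)`. -/
def G (R : Type u) [CommRing R] : Subgroup (GL (Fin 7) R) where
  carrier := {g | ∃ c : Rˣ, act3 (g : Matrix (Fin 7) (Fin 7) R) (wBar R) = (c : R) • wBar R}
  one_mem' := ⟨1, by simp [act3_one]⟩
  mul_mem' := by
    rintro g h ⟨c, hc⟩ ⟨d, hd⟩
    refine ⟨c * d, ?_⟩
    rw [Units.val_mul, act3_mul, hd, map_smul, hc, smul_smul, Units.val_mul, mul_comm]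
  inv_mem' := by
    rintro g ⟨c, hc⟩
    refine ⟨c⁻¹, ?_⟩
    have h : act3 ((g⁻¹ : GL (Fin 7) R) : Matrix (Fin 7) (Fin 7) R)
        (act3 (g : Matrix (Fin 7) (Fin 7) R) (wBar R)) = wBar R := by
      rw [← act3_mul, ← Units.val_mul, inv_mul_cancel, Units.val_one, act3_one]
    rw [hc, map_smul] at h
    calc act3 ((g⁻¹ : GL (Fin 7) R) : Matrix (Fin 7) (Fin 7) R) (wBar R)
        = ((c⁻¹ : Rˣ) : R) • ((c : R) •
          act3 ((g⁻¹ : GL (Fin 7) R) : Matrix (Fin 7) (Fin 7) R) (wBar R)) := by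
            rw [smul_smul, Units.inv_mul, one_smul]
      _ = _ := by rw [h]

/-- The `R`-valued points of the stabilizer `G_x` in `G` of a vector `x ∈ V_k = k⁷`. -/
def stabilizer {k : Type u} [Field k] (x : Fin 7 → k)
    (R : Type u) [CommRing R] [Algebra k R] : Subgroup (GL (Fin 7) R) where
  carrier := {g | g ∈ G R ∧
    (g : Matrix (Fin 7) (Fin 7) R) *ᵥ (fun i => algebraMap k R (x i)) =
      fun i => algebraMap k R (x i)}
  one_mem' := ⟨one_mem _, by simp⟩
  mul_mem' := by
    rintro g h ⟨hg, hg'⟩ ⟨hh, hh'⟩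
    refine ⟨mul_mem hg hh, ?_⟩
    rw [Units.val_mul, ← Matrix.mulVec_mulVec, hh', hg']
  inv_mem' := by
    rintro g ⟨hg, hg'⟩
    refine ⟨inv_mem hg, ?_⟩
    conv_lhs => rw [← hg']
    rw [Matrix.mulVec_mulVec, ← Units.val_mul, inv_mul_cancel, Units.val_one, Matrix.one_mulVec]

end Group

/-! ### The elements `d(A)`, `g_α` and the group `SU_α(2, 1)` -/

/-- `d(A)` is the block diagonal matrix with blocks `1`, `A`, `ᵗA⁻¹`. -/
def d {S : Type u} [CommRing S] (A : SL(3, S)) : Matrix (Fin 7) (Fin 7) S :=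
  let B : Matrix (Fin 3) (Fin 3) S := ((A⁻¹ : SL(3, S)) : Matrix (Fin 3) (Fin 3) S)ᵀ
  !![1, 0, 0, 0, 0, 0, 0;
     0, A 0 0, A 0 1, A 0 2, 0, 0, 0;
     0, A 1 0, A 1 1, A 1 2, 0, 0, 0;
     0, A 2 0, A 2 1, A 2 2, 0, 0, 0;
     0, 0, 0, 0, B 0 0, B 0 1, B 0 2;
     0, 0, 0, 0, B 1 0, B 1 1, B 1 2;
     0, 0, 0, 0, B 2 0, B 2 1, B 2 2]

/-- `Λ = diag(1, 1, -1)`. -/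
def Lam (S : Type u) [CommRing S] : Matrix (Fin 3) (Fin 3) S := Matrix.diagonal ![1, 1, -1]

section Point

variable {K : Type u} [Field K]

/-- The matrix `g_α`. -/
def gMat (α : K) : Matrix (Fin 7) (Fin 7) K :=
  !![0, -α, 0, 0, α, 0, 0;
     α ^ 2 / 2, α ^ 2 / 2, 0, 0, α ^ 2 / 2, 0, 0;
     0, 0, α / 2, -α / 2, 0, -α / 2, -α / 2;
     0, 0, 1 / 2, 1 / 2, 0, 1 / 2, -1 / 2;
     -1 / 2, 1 / 2, 0, 0, 1 / 2, 0, 0;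
     0, 0, -α / 2, -α / 2, 0, α / 2, -α / 2;
     0, 0, α ^ 2 / 2, -α ^ 2 / 2, 0, α ^ 2 / 2, α ^ 2 / 2]

/-- The vector `g_α w`, where `w = ᵗ(1, 0, …, 0)`. -/
def wVec (α : K) : Fin 7 → K := gMat α *ᵥ e K 0

/-- `g_α w = ᵗ(0, α²/2, 0, 0, -1/2, 0, 0)`. -/
theorem wVec_eq (α : K) : wVec α = ![0, α ^ 2 / 2, 0, 0, -1 / 2, 0, 0] := by
  ext i
  fin_cases i <;> simp [wVec, e, gMat]

/-- `g_α` is invertible for `α ≠ 0` in characteristic zero, so that `(gMat α)⁻¹` is its inverse. -/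
theorem gMat_mul_inv [CharZero K] (α : K) (hα : α ≠ 0) : gMat α * (gMat α)⁻¹ = 1 := by
  have h : gMat α *
      !![0, 1 / α ^ 2, 0, 0, -1, 0, 0;
         -1 / (2 * α), 1 / (2 * α ^ 2), 0, 0, 1 / 2, 0, 0;
         0, 0, 1 / (2 * α), 1 / 2, 0, -1 / (2 * α), 1 / (2 * α ^ 2);
         0, 0, -1 / (2 * α), 1 / 2, 0, -1 / (2 * α), -1 / (2 * α ^ 2);
         1 / (2 * α), 1 / (2 * α ^ 2), 0, 0, 1 / 2, 0, 0;
         0, 0, -1 / (2 * α), 1 / 2, 0, 1 / (2 * α), 1 / (2 * α ^ 2);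
         0, 0, -1 / (2 * α), -1 / 2, 0, -1 / (2 * α), 1 / (2 * α ^ 2)] = 1 := by
    ext i j
    fin_cases i <;> fin_cases j <;>
      simp [gMat, Matrix.mul_apply, Fin.sum_univ_succ] <;> field_simp <;> norm_num
  rw [Matrix.inv_eq_right_inv h, h]

end Point

section SU

variable {k K : Type u} [Field k] [Field K] [Algebra k K]

/-- The action of `σ` on `R(α) = R ⊗ k(α)` by `(r ⊗ x)^σ = r ⊗ x^σ`. -/
def conj (σ : K ≃ₐ[k] K) (R : Type u) [CommRing R] [Algebra k R] :
    R ⊗[k] K →ₐ[k] R ⊗[k] K :=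
  Algebra.TensorProduct.map (AlgHom.id k R) (σ : K →ₐ[k] K)

/-- `*A = ᵗ(A^σ)`, the conjugation being entry-wise. -/
def star' (σ : K ≃ₐ[k] K) {R : Type u} [CommRing R] [Algebra k R]
    (A : Matrix (Fin 3) (Fin 3) (R ⊗[k] K)) : Matrix (Fin 3) (Fin 3) (R ⊗[k] K) :=
  (A.map (conj σ R))ᵀ

theorem star'_mul (σ : K ≃ₐ[k] K) {R : Type u} [CommRing R] [Algebra k R]
    (A B : Matrix (Fin 3) (Fin 3) (R ⊗[k] K)) : star' σ (A * B) = star' σ B * star' σ A := by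
  simp [star', Matrix.map_mul, Matrix.transpose_mul]

theorem star'_one (σ : K ≃ₐ[k] K) {R : Type u} [CommRing R] [Algebra k R] :
    star' σ (1 : Matrix (Fin 3) (Fin 3) (R ⊗[k] K)) = 1 := by
  simp [star']

/-- The `R`-valued points of `SU_α(2, 1)`: the `A ∈ SL(3, R(α))` with `A Λ *A = Λ`. -/
def SU (σ : K ≃ₐ[k] K) (R : Type u) [CommRing R] [Algebra k R] :
    Subgroup (SL(3, R ⊗[k] K)) where
  carrier := {A | (A : Matrix (Fin 3) (Fin 3) (R ⊗[k] K)) * Lam (R ⊗[k] K) *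
    star' σ (A : Matrix (Fin 3) (Fin 3) (R ⊗[k] K)) = Lam (R ⊗[k] K)}
  one_mem' := by simp [star'_one]
  mul_mem' := by
    intro A B hA hB
    simp only [Set.mem_ofPred_eq, Matrix.SpecialLinearGroup.coe_mul, star'_mul] at hA hB ⊢
    calc _ = A.1 * (B.1 * Lam (R ⊗[k] K) * star' σ B.1) * star' σ A.1 := by
            simp only [Matrix.mul_assoc]
      _ = _ := by rw [hB, hA]
  inv_mem' := by
    intro A hA
    simp only [Set.mem_ofPred_eq] at hA ⊢
    have h1 : ((A⁻¹ : SL(3, R ⊗[k] K)) : Matrix (Fin 3) (Fin 3) (R ⊗[k] K)) * A.1 = 1 := by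
      rw [← Matrix.SpecialLinearGroup.coe_mul, inv_mul_cancel, Matrix.SpecialLinearGroup.coe_one]
    have h2 : star' σ A.1 *
        star' σ ((A⁻¹ : SL(3, R ⊗[k] K)) : Matrix (Fin 3) (Fin 3) (R ⊗[k] K)) = 1 := by
      rw [← star'_mul, h1, star'_one]
    conv_lhs => rw [← hA]
    calc _ = ((A⁻¹ : SL(3, R ⊗[k] K)).1 * A.1) * Lam (R ⊗[k] K) *
          (star' σ A.1 * star' σ (A⁻¹ : SL(3, R ⊗[k] K)).1) := by
            simp only [Matrix.mul_assoc]
      _ = _ := by rw [h1, h2, Matrix.one_mul, Matrix.mul_one]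

/-- The map `R(α) → S(α)` induced by a homomorphism `R → S` of `k`-algebras. -/
def baseMap (K : Type u) [Field K] [Algebra k K] {R S : Type u} [CommRing R] [Algebra k R]
    [CommRing S] [Algebra k S] (f : R →ₐ[k] S) : R ⊗[k] K →ₐ[k] S ⊗[k] K :=
  Algebra.TensorProduct.map f (AlgHom.id k K)

theorem conj_baseMap (σ : K ≃ₐ[k] K) {R S : Type u} [CommRing R] [Algebra k R]
    [CommRing S] [Algebra k S] (f : R →ₐ[k] S) (x : R ⊗[k] K) :
    conj σ S (baseMap K f x) = baseMap K f (conj σ R x) := by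
  induction x with
  | zero => simp
  | tmul r y => simp [conj, baseMap]
  | add x y hx hy => simp only [map_add, hx, hy]

/-- Functoriality of `R ↦ SU_α(2, 1)_R`: entry-wise application of `R(α) → S(α)`. -/
def SU.map (σ : K ≃ₐ[k] K) {R S : Type u} [CommRing R] [Algebra k R]
    [CommRing S] [Algebra k S] (f : R →ₐ[k] S) : SU σ R →* SU σ S where
  toFun A := ⟨Matrix.SpecialLinearGroup.map (baseMap K f : R ⊗[k] K →+* S ⊗[k] K) A.1, by
    have h := congrArg (fun M => M.map (baseMap K f)) A.2
    simp only [Matrix.map_mul] at h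
    have hL : (Lam (R ⊗[k] K)).map (baseMap K f) = Lam (S ⊗[k] K) := by
      ext i j
      fin_cases i <;> fin_cases j <;> simp [Lam]
    have hs : (star' σ (A.1 : Matrix (Fin 3) (Fin 3) (R ⊗[k] K))).map (baseMap K f) =
        star' σ ((A.1 : Matrix (Fin 3) (Fin 3) (R ⊗[k] K)).map (baseMap K f)) := by
      ext i j
      simp [star', conj_baseMap]
    rw [hL, hs] at h
    exact h⟩
  map_one' := by
    apply Subtype.ext
    simp
  map_mul' A B := by
    apply Subtype.ext
    simp

end SU

section Conjugate

variable {k K : Type u} [Field k] [Field K] [Algebra k K]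

/-- The element `g_α d(A) g_α⁻¹` over `R(α)`. -/
def conjugate (α : K) {R : Type u} [CommRing R] [Algebra k R] (A : SL(3, R ⊗[k] K)) :
    Matrix (Fin 7) (Fin 7) (R ⊗[k] K) :=
  let ι : K →ₐ[k] R ⊗[k] K := Algebra.TensorProduct.includeRight
  (gMat α).map ι * d A * ((gMat α)⁻¹).map ι

/-- An `R`-valued matrix, regarded as a matrix over `R(α)` through `r ↦ r ⊗ 1`. -/
def extend (k K : Type u) [Field k] [Field K] [Algebra k K] {R : Type u} [CommRing R]
    [Algebra k R] (g : GL (Fin 7) R) : Matrix (Fin 7) (Fin 7) (R ⊗[k] K) :=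
  (g : Matrix (Fin 7) (Fin 7) R).map
    (Algebra.TensorProduct.includeLeft : R →ₐ[k] R ⊗[k] K)

end Conjugate

end G2Prehomogeneous

end

/-! Since `g_α` multiplies `w̄` by `α³` and sends `w` to `w_α`, conjugation by it reduces questions
over `k(α)`-algebras to similitudes `g` of `w̄` fixing `w`. The rows of such a `g` other than the
first lie in a six-dimensional space of covectors, on which `w̄` is the sum of two determinants of
order three. If `(A, B; C, D)` are the 3×3 blocks and `c` is the multiplier, invariance says that
this matrix times a matrix of adjugates is `c`. Hence `det D = det A = a`, `det C = det B = b`, `a +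
b = c` and `ab = 0`. If `b = 0`, then `B = C = 0`, `c = 1` and `g = d(A)`; if `a = 0`, then `c = -1`
(`IsSimil.of_offdiag_det`, `IsSimil.of_diag_det`).

The multiplier is a polynomial in the entries and equals `1` or `-1` at each point of `G_{w_α}`. As
`2` is invertible, these values give disjoint closed sets, so the multiplier is `1` on the points of
the identity component. For points over an arbitrary ring this forces `b` to be nilpotent, and then
zero (`IsSimil.exists_eq_conjBy`). Conversely, all matrices `g_α d(A) g_α⁻¹` are specializations of
one such matrix over an integral domain (`exists_generic_SL3`), so their points lie in one connected
set through `1`.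

For the descent to `k`, `σ` sends `g_α` to `g_{-α} = g_α τ`, where `τ` exchanges the two blocks with
signs `Λ`. Conjugation by `τ` replaces `A` by `Λ ᵗA⁻¹ Λ`; thus `g_α d(A) g_α⁻¹` is fixed by `σ`,
that is, has entries in `R`, exactly when `A Λ *A = Λ` (`map_conj_conjugate_iff`). Multiplicativity
and naturality are then checked in `R(α)`, which contains `R`. -/

namespace G2Prehomogeneous

/-! ### The trilinear form dual to `w̄` -/

section Trilinear

variable {S : Type u} [CommRing S]

/-- The `3 × 3` minor with columns `i, j, l` of the matrix with rows `x, y, z`. -/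
def minor3 (i j l : Fin 7) (x y z : Fin 7 → S) : S :=
  x i * (y j * z l - y l * z j) - x j * (y i * z l - y l * z i) + x l * (y i * z j - y j * z i)

/-- The value of the trivector `w̄` at three covectors. -/
def tri (x y z : Fin 7 → S) : S :=
  minor3 1 2 3 x y z + minor3 4 5 6 x y z +
    (minor3 0 1 4 x y z + minor3 0 2 5 x y z + minor3 0 3 6 x y z)

theorem map_tri {S' : Type u} [CommRing S'] (f : S →+* S') (x y z : Fin 7 → S) :
    f (tri x y z) = tri (f ∘ x) (f ∘ y) (f ∘ z) := by
  simp [tri, minor3]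

theorem comp_e {S' : Type u} [CommRing S'] (f : S →+* S') (i : Fin 7) :
    f ∘ e S i = e S' i := by
  ext j
  simp [e, Pi.single_apply, apply_ite f]

/-- `tri` as a multilinear map. -/
noncomputable def triMap (S : Type u) [CommRing S] :
    MultilinearMap S (fun _ : Fin 3 => Fin 7 → S) S where
  toFun v := tri (v 0) (v 1) (v 2)
  map_update_add' v i x y := by
    have : ‹DecidableEq (Fin 3)› = instDecidableEqFin 3 := Subsingleton.elim _ _
    subst this
    fin_cases i <;> simp [Function.update, tri, minor3] <;> ring
  map_update_smul' v i c x := by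
    have : ‹DecidableEq (Fin 3)› = instDecidableEqFin 3 := Subsingleton.elim _ _
    subst this
    fin_cases i <;> simp [Function.update, tri, minor3] <;> ring

/-- `g` multiplies the trivector `w̄` by `c`, expressed on the standard basis. -/
def IsSimil (g : Matrix (Fin 7) (Fin 7) S) (c : S) : Prop :=
  ∀ i j l, tri (g i) (g j) (g l) = c * tri (e S i) (e S j) (e S l)

theorem e_vecMul (g : Matrix (Fin 7) (Fin 7) S) (i : Fin 7) : e S i ᵥ* g = g i := by
  simp [e, Matrix.row]

theorem IsSimil.tri_vecMul {g : Matrix (Fin 7) (Fin 7) S} {c : S} (h : IsSimil g c)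
    (x y z : Fin 7 → S) : tri (x ᵥ* g) (y ᵥ* g) (z ᵥ* g) = c * tri x y z := by
  have key : (triMap S).compLinearMap (fun _ => g.vecMulLinear) = c • triMap S := by
    refine Module.Basis.ext_multilinear (fun _ => Pi.basisFun S (Fin 7)) fun v => ?_
    have := h (v 0) (v 1) (v 2)
    simpa [triMap, e, Matrix.row] using this
  simpa [triMap] using congrArg (fun f => f ![x, y, z]) key

theorem IsSimil.mul {g h : Matrix (Fin 7) (Fin 7) S} {c c' : S} (hg : IsSimil g c)
    (hh : IsSimil h c') : IsSimil (g * h) (c * c') := by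
  intro i j l
  have := hh.tri_vecMul (g i) (g j) (g l)
  rw [hg i j l, ← mul_assoc, mul_comm c'] at this
  simpa [← e_vecMul (g * h), ← Matrix.vecMul_vecMul, e_vecMul] using this

theorem IsSimil.map {S' : Type u} [CommRing S'] (f : S →+* S') {g : Matrix (Fin 7) (Fin 7) S}
    {c : S} (hg : IsSimil g c) : IsSimil (g.map f) (f c) := by
  intro i j l
  have := congrArg f (hg i j l)
  rw [map_mul, map_tri, map_tri, comp_e, comp_e, comp_e] at this
  exact this

theorem IsSimil.of_map {S' : Type u} [CommRing S'] (f : S →+* S') (hf : Function.Injective f)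
    {g : Matrix (Fin 7) (Fin 7) S} {c : S} (hg : IsSimil (g.map f) (f c)) : IsSimil g c := by
  intro i j l
  apply hf
  rw [map_mul, map_tri, map_tri, comp_e, comp_e, comp_e]
  exact hg i j l

theorem tri_e : tri (e S 1) (e S 2) (e S 3) = 1 := by
  simp [tri, minor3, e]

/-- This makes the multiplier a regular function on the space of matrices, so that its values cut
out closed sets. -/
theorem IsSimil.eq_tri {g : Matrix (Fin 7) (Fin 7) S} {c : S} (hg : IsSimil g c) :
    c = tri (g 1) (g 2) (g 3) := by
  rw [hg 1 2 3, tri_e, mul_one]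

theorem IsSimil.inv {g h : Matrix (Fin 7) (Fin 7) S} {c : Sˣ} (hg : IsSimil g c)
    (hgh : h * g = 1) : IsSimil h (c⁻¹ : Sˣ) := by
  intro i j l
  have := hg.tri_vecMul (h i) (h j) (h l)
  rw [← e_vecMul h, ← e_vecMul h, ← e_vecMul h] at this
  simp only [Matrix.vecMul_vecMul, hgh, Matrix.vecMul_one] at this
  rw [this, Units.inv_mul_cancel_left]
  simp only [e_vecMul]

/-- The linear form on `⋀³ W` given by three covectors. -/
noncomputable def pairing (x : Fin 3 → Fin 7 → S) : ⋀[S]^3 (Fin 7 → S) →ₗ[S] S :=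
  exteriorPower.pairingDual S (Fin 7 → S) 3
    (exteriorPower.ιMulti S 3 fun r => dotProductBilin S S (x r))

theorem pairing_ιMulti (x v : Fin 3 → Fin 7 → S) :
    pairing x (exteriorPower.ιMulti S 3 v) = Matrix.det (Matrix.of fun i j => x j ⬝ᵥ v i) := by
  simp [pairing]

theorem pairing_act3 (g : Matrix (Fin 7) (Fin 7) S) (x : Fin 3 → Fin 7 → S)
    (w : ⋀[S]^3 (Fin 7 → S)) : pairing x (act3 g w) = pairing (fun r => x r ᵥ* g) w := by
  have : pairing x ∘ₗ act3 g = pairing (fun r => x r ᵥ* g) := by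
    apply exteriorPower.linearMap_ext
    ext v
    simp [act3, pairing_ιMulti, Matrix.dotProduct_mulVec]
  exact congrArg (fun f => f w) this

theorem pairing_wBar (x : Fin 3 → Fin 7 → S) : pairing x (wBar S) = tri (x 0) (x 1) (x 2) := by
  simp [wBar, e3, pairing_ιMulti, Matrix.det_fin_three, e, tri, minor3]
  ring

/-- The pairings with triples of basis covectors include the dual basis of `⋀³ W`. -/
theorem eq_of_pairing {w w' : ⋀[S]^3 (Fin 7 → S)}
    (h : ∀ i j l, pairing ![e S i, e S j, e S l] w = pairing ![e S i, e S j, e S l] w') :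
    w = w' := by
  apply ((Pi.basisFun S (Fin 7)).exteriorPower 3).ext_elem
  intro s
  rw [exteriorPower.basis_repr_apply, exteriorPower.basis_repr_apply]
  have key : exteriorPower.ιMultiDual S 3 (Pi.basisFun S (Fin 7)) s =
      pairing ![e S (Set.powersetCard.ofFinEmbEquiv.symm s 0),
        e S (Set.powersetCard.ofFinEmbEquiv.symm s 1),
        e S (Set.powersetCard.ofFinEmbEquiv.symm s 2)] := by
    apply exteriorPower.linearMap_ext
    ext v
    rw [LinearMap.compAlternatingMap_apply, LinearMap.compAlternatingMap_apply,
      exteriorPower.ιMultiDual_apply_ιMulti, pairing_ιMulti]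
    congr 1
    ext i j
    fin_cases j <;> simp [e]
  rw [key]
  exact h _ _ _

/-- The action on trivectors is transposed to `x ↦ x ᵥ* g` on covectors, which turns the equation in
`⋀³ W` into scalar equations between rows of `g`. -/
theorem act3_wBar_iff (g : Matrix (Fin 7) (Fin 7) S) (c : S) :
    act3 g (wBar S) = c • wBar S ↔ IsSimil g c := by
  have h1 : ∀ i j l, pairing ![e S i, e S j, e S l] (act3 g (wBar S)) =
      tri (g i) (g j) (g l) := by
    intro i j l
    rw [pairing_act3, pairing_wBar]
    simp [e_vecMul]
  have h2 : ∀ i j l, pairing ![e S i, e S j, e S l] (c • wBar S) =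
      c * tri (e S i) (e S j) (e S l) := by
    intro i j l
    rw [map_smul, pairing_wBar, smul_eq_mul]
    simp
  constructor
  · intro h i j l
    rw [← h1, ← h2, h]
  · intro h
    apply eq_of_pairing
    intro i j l
    rw [h1, h2, h]

theorem mem_G_iff (g : GL (Fin 7) S) :
    g ∈ G S ↔ ∃ c : Sˣ, IsSimil (g : Matrix (Fin 7) (Fin 7) S) c :=
  exists_congr fun _ => act3_wBar_iff _ _

end Trilinear


/-! ### Relations between the 3×3 blocks -/

section Blocks

variable {S : Type u} [CommRing S]

/-- If `A adj(A) + B adj(B) = c`, etc., the `6 × 6` block matrix `(A, B; C, D)` is, up to the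
scalar `c`, inverse to the one with blocks `adj(A), adj(C), adj(B), adj(D)`; comparing the other
product gives a further relation between the determinants. -/
theorem det_add_det_of_block_mul {A B C D : Matrix (Fin 3) (Fin 3) S} {c : S} (hc : IsUnit c)
    (h1 : A.det + B.det = c) (h2 : C.det + D.det = c)
    (h3 : C * A.adjugate + D * B.adjugate = 0) (h4 : A * C.adjugate + B * D.adjugate = 0) :
    B.det + D.det = c := by
  obtain ⟨c, rfl⟩ := hc
  have hM : Matrix.fromBlocks A B C D *
      ((c⁻¹ : Sˣ) : S) • Matrix.fromBlocks A.adjugate C.adjugate B.adjugate D.adjugate = 1 := by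
    rw [Matrix.mul_smul, Matrix.fromBlocks_multiply, h3, h4, Matrix.mul_adjugate,
      Matrix.mul_adjugate, Matrix.mul_adjugate, Matrix.mul_adjugate, ← add_smul, ← add_smul,
      h1, h2, Matrix.fromBlocks_smul, smul_smul, Units.inv_mul]
    simp
  have hN := mul_eq_one_comm.mp hM
  have hN' : Matrix.fromBlocks A.adjugate C.adjugate B.adjugate D.adjugate *
      Matrix.fromBlocks A B C D = (c : S) • 1 := by
    rw [← hN, Matrix.smul_mul, smul_smul, Units.mul_inv, one_smul]
  rw [Matrix.fromBlocks_multiply, ← Matrix.fromBlocks_one, Matrix.fromBlocks_smul] at hN'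
  have e4 := (Matrix.fromBlocks_inj.mp hN').2.2.2
  rw [Matrix.adjugate_mul, Matrix.adjugate_mul, ← add_smul] at e4
  simpa using congrFun (congrFun e4 0) 0

theorem adjugate_neg_fin_three (A : Matrix (Fin 3) (Fin 3) S) :
    (-A).adjugate = A.adjugate := by
  simpa using Matrix.adjugate_smul (-1 : S) A

theorem adjugate_adjugate_fin_three (A : Matrix (Fin 3) (Fin 3) S) :
    A.adjugate.adjugate = A.det • A := by
  simpa using Matrix.adjugate_adjugate A (by simp)

theorem adjugate_zero_fin_three : (0 : Matrix (Fin 3) (Fin 3) S).adjugate = 0 := by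
  simp

theorem eq_zero_of_isUnit_smul {ι κ : Type*} {c : S} (hc : IsUnit c) {A : Matrix ι κ S}
    (h : c • A = 0) : A = 0 := by
  obtain ⟨c, rfl⟩ := hc
  ext i j
  have := congrFun (congrFun h i) j
  simpa using this

/-- Taking adjugates in `C adj(A) = -D adj(B)` gives `c A adj(C) = det(B) B adj(D) = 0`. Then `h4`
leaves `B adj(D) = 0`, and `D` is invertible, so `B = 0`; now `h3` leaves `C adj(A) = 0`, so `C =
0`. -/
theorem block_offdiag_eq_zero {A B C D : Matrix (Fin 3) (Fin 3) S} {c : S} (hc : IsUnit c)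
    (hA : A.det = c) (hD : D.det = c) (hB : B.det = 0)
    (h3 : C * A.adjugate + D * B.adjugate = 0) (h4 : A * C.adjugate + B * D.adjugate = 0) :
    B = 0 ∧ C = 0 := by
  have h5 : A * C.adjugate = 0 := by
    have := congrArg Matrix.adjugate (eq_neg_of_add_eq_zero_left h3)
    rw [adjugate_neg_fin_three, Matrix.adjugate_mul_distrib, Matrix.adjugate_mul_distrib,
      adjugate_adjugate_fin_three, adjugate_adjugate_fin_three, hB, zero_smul, zero_mul,
      hA, Matrix.smul_mul] at this
    exact eq_zero_of_isUnit_smul hc this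
  have hB0 : B = 0 := by
    rw [h5, zero_add] at h4
    have := congrArg (· * D) h4
    simp only [Matrix.mul_assoc, Matrix.adjugate_mul, hD, zero_mul, Matrix.mul_smul,
      Matrix.mul_one] at this
    exact eq_zero_of_isUnit_smul hc this
  refine ⟨hB0, ?_⟩
  rw [hB0, adjugate_zero_fin_three, mul_zero, add_zero] at h3
  have := congrArg (· * A) h3
  simp only [Matrix.mul_assoc, Matrix.adjugate_mul, hA, zero_mul, Matrix.mul_smul,
    Matrix.mul_one] at this
  exact eq_zero_of_isUnit_smul hc this

/-- The `3 × 3` block of a `7 × 7` matrix with rows `r` and columns `s`. -/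
def block (r s : Fin 3 → Fin 7) (g : Matrix (Fin 7) (Fin 7) S) : Matrix (Fin 3) (Fin 3) S :=
  g.submatrix r s

/-- The upper half of the indices of the hyperplane. -/
abbrev up : Fin 3 → Fin 7 := ![1, 2, 3]

/-- The lower half of the indices of the hyperplane. -/
abbrev lo : Fin 3 → Fin 7 := ![4, 5, 6]

variable {g : Matrix (Fin 7) (Fin 7) S} {c : S}

theorem col_zero (h0 : g *ᵥ e S 0 = e S 0) (i : Fin 7) : g i 0 = e S 0 i := by
  rw [← h0]
  simp [e, Matrix.col]

theorem IsSimil.block_det_up (hg : IsSimil g c) (h0 : g *ᵥ e S 0 = e S 0) :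
    (block up up g).det + (block up lo g).det = c := by
  have h := hg 1 2 3
  rw [tri_e, mul_one] at h
  have h1 : g 1 0 = 0 := by simp [col_zero h0, e]
  have h2 : g 2 0 = 0 := by simp [col_zero h0, e]
  have h3 : g 3 0 = 0 := by simp [col_zero h0, e]
  simp only [tri, minor3, h1, h2, h3] at h
  simp only [Matrix.det_fin_three, block, Matrix.submatrix_apply, up, lo]
  simp
  linear_combination h

theorem IsSimil.block_det_lo (hg : IsSimil g c) (h0 : g *ᵥ e S 0 = e S 0) :
    (block lo up g).det + (block lo lo g).det = c := by
  have h := hg 4 5 6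
  have ht : tri (e S 4) (e S 5) (e S 6) = 1 := by simp [tri, minor3, e]
  rw [ht, mul_one] at h
  have h1 : g 4 0 = 0 := by simp [col_zero h0, e]
  have h2 : g 5 0 = 0 := by simp [col_zero h0, e]
  have h3 : g 6 0 = 0 := by simp [col_zero h0, e]
  simp only [tri, minor3, h1, h2, h3] at h
  simp only [Matrix.det_fin_three, block, Matrix.submatrix_apply, up, lo]
  simp
  linear_combination h

theorem IsSimil.block_adj_up (hg : IsSimil g c) (h0 : g *ᵥ e S 0 = e S 0) :
    block lo up g * (block up up g).adjugate + block lo lo g * (block up lo g).adjugate = 0 := by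
  have hz : ∀ i : Fin 7, i ≠ 0 → g i 0 = 0 := fun i hi => by simp [col_zero h0, e, hi]
  have key : ∀ i j l : Fin 7, i ≠ 0 → j ≠ 0 → l ≠ 0 →
      tri (e S i) (e S j) (e S l) = 0 →
      minor3 1 2 3 (g i) (g j) (g l) + minor3 4 5 6 (g i) (g j) (g l) = 0 := by
    intro i j l hi hj hl h
    have := hg i j l
    rw [h, mul_zero] at this
    simp only [tri, minor3, hz i hi, hz j hj, hz l hl] at this
    simp only [minor3]
    linear_combination this
  ext k j
  -- The indices are cyclic in `Fin 3`: the 2×2 minors of rows `j + 1`, `j + 2` are the cofactors of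
  -- row `j` with the right signs.
  have h := key (lo k) (up (j + 1)) (up (j + 2))
    (by fin_cases k <;> decide) (by fin_cases j <;> decide) (by fin_cases j <;> decide)
    (by fin_cases k <;> fin_cases j <;> simp [tri, minor3, e])
  simp only [Matrix.add_apply, Matrix.mul_apply, Fin.sum_univ_three, Matrix.adjugate_fin_three,
    block, Matrix.zero_apply, Matrix.submatrix_apply]
  fin_cases j <;> simp [minor3] at h ⊢ <;> linear_combination h

theorem IsSimil.block_adj_lo (hg : IsSimil g c) (h0 : g *ᵥ e S 0 = e S 0) :
    block up up g * (block lo up g).adjugate + block up lo g * (block lo lo g).adjugate = 0 := by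
  have hz : ∀ i : Fin 7, i ≠ 0 → g i 0 = 0 := fun i hi => by simp [col_zero h0, e, hi]
  have key : ∀ i j l : Fin 7, i ≠ 0 → j ≠ 0 → l ≠ 0 →
      tri (e S i) (e S j) (e S l) = 0 →
      minor3 1 2 3 (g i) (g j) (g l) + minor3 4 5 6 (g i) (g j) (g l) = 0 := by
    intro i j l hi hj hl h
    have := hg i j l
    rw [h, mul_zero] at this
    simp only [tri, minor3, hz i hi, hz j hj, hz l hl] at this
    simp only [minor3]
    linear_combination this
  ext k j
  have h := key (up k) (lo (j + 1)) (lo (j + 2))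
    (by fin_cases k <;> decide) (by fin_cases j <;> decide) (by fin_cases j <;> decide)
    (by fin_cases k <;> fin_cases j <;> simp [tri, minor3, e])
  simp only [Matrix.add_apply, Matrix.mul_apply, Fin.sum_univ_three, Matrix.adjugate_fin_three,
    block, Matrix.zero_apply, Matrix.submatrix_apply]
  fin_cases j <;> simp [minor3] at h ⊢ <;> linear_combination h

end Blocks


/-! ### Similitudes fixing the first basis vector -/

section Fixator

variable {S : Type u} [CommRing S] {g : Matrix (Fin 7) (Fin 7) S} {c : S}

theorem IsSimil.block_det_eq (hg : IsSimil g c) (hc : IsUnit c) (h0 : g *ᵥ e S 0 = e S 0) :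
    (block lo lo g).det = (block up up g).det ∧ (block lo up g).det = (block up lo g).det ∧
      (block up up g).det * (block up lo g).det = 0 := by
  have h1 := hg.block_det_up h0
  have h2 := hg.block_det_lo h0
  have h3 := hg.block_adj_up h0
  have h5 := det_add_det_of_block_mul hc h1 h2 h3 (hg.block_adj_lo h0)
  have hD : (block lo lo g).det = (block up up g).det := by linear_combination h5 - h1
  have hC : (block lo up g).det = (block up lo g).det := by linear_combination h2 - h5
  refine ⟨hD, hC, ?_⟩
  -- With `a`, `b` the determinants of the two upper blocks, this reads `b a² = -a b²`, that is
  -- `ab(a + b) = 0`, and `a + b = c` is a unit.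
  have h6 := congrArg Matrix.det (eq_neg_of_add_eq_zero_left h3)
  rw [Matrix.det_neg, Matrix.det_mul, Matrix.det_mul, Matrix.det_adjugate, Matrix.det_adjugate,
    hD, hC] at h6
  simp only [Fintype.card_fin] at h6
  have h7 : (block up up g).det * (block up lo g).det * c = 0 := by
    rw [← h1]
    linear_combination h6
  exact (hc.mul_left_eq_zero).mp h7

theorem tri_e_zero_up_lo (i j : Fin 3) : tri (e S 0) (e S (up i)) (e S (lo j)) =
    (1 : Matrix (Fin 3) (Fin 3) S) i j := by
  fin_cases i <;> fin_cases j <;> simp [tri, minor3, e, up, lo]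

theorem eq_zero_or_up_or_lo (i : Fin 7) : i = 0 ∨ (∃ j, i = up j) ∨ ∃ j, i = lo j := by
  revert i
  decide

section BlocksOfD

variable (A : SL(3, S)) (i j : Fin 3)

theorem d_zero_zero : d A 0 0 = 1 := rfl

theorem d_zero_up : d A 0 (up j) = 0 := by fin_cases j <;> rfl

theorem d_zero_lo : d A 0 (lo j) = 0 := by fin_cases j <;> rfl

theorem d_up_zero : d A (up i) 0 = 0 := by fin_cases i <;> rfl

theorem d_lo_zero : d A (lo i) 0 = 0 := by fin_cases i <;> rfl

theorem d_up_up : d A (up i) (up j) = A i j := by fin_cases i <;> fin_cases j <;> rfl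

theorem d_up_lo : d A (up i) (lo j) = 0 := by fin_cases i <;> fin_cases j <;> rfl

theorem d_lo_up : d A (lo i) (up j) = 0 := by fin_cases i <;> fin_cases j <;> rfl

theorem d_lo_lo : d A (lo i) (lo j) = A⁻¹ j i := by fin_cases i <;> fin_cases j <;> rfl

end BlocksOfD

theorem eq_d {A : SL(3, S)} (hz : ∀ i, g i 0 = e S 0 i) (hp : ∀ j, g 0 (up j) = 0)
    (hp' : ∀ j, g 0 (lo j) = 0) (hB : ∀ i j, g (up i) (lo j) = 0)
    (hC : ∀ i j, g (lo i) (up j) = 0) (hA : ∀ i j, g (up i) (up j) = A i j)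
    (hD : ∀ i j, g (lo i) (lo j) = A⁻¹ j i) : g = d A := by
  ext i j
  rcases eq_zero_or_up_or_lo j with rfl | ⟨j, rfl⟩ | ⟨j, rfl⟩
  · rw [hz]
    rcases eq_zero_or_up_or_lo i with rfl | ⟨i, rfl⟩ | ⟨i, rfl⟩
    · rw [d_zero_zero]; simp [e]
    · rw [d_up_zero]; fin_cases i <;> simp [e]
    · rw [d_lo_zero]; fin_cases i <;> simp [e]
  · rcases eq_zero_or_up_or_lo i with rfl | ⟨i, rfl⟩ | ⟨i, rfl⟩
    · rw [hp, d_zero_up]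
    · rw [hA, d_up_up]
    · rw [hC, d_lo_up]
  · rcases eq_zero_or_up_or_lo i with rfl | ⟨i, rfl⟩ | ⟨i, rfl⟩
    · rw [hp', d_zero_lo]
    · rw [hB, d_up_lo]
    · rw [hD, d_lo_lo]

/-- The off-diagonal blocks vanish. The part of `w̄` involving `e_1` then gives `A ᵗD = c`, and
determinants give `c² = c³`. The remaining equations, with one index `0` and two in the same half,
kill the rest of the first row because the diagonal blocks are invertible. -/
theorem IsSimil.of_offdiag_det (hg : IsSimil g c) (hc : IsUnit c) (h0 : g *ᵥ e S 0 = e S 0)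
    (hb : (block up lo g).det = 0) :
    c = 1 ∧ ∃ A : SL(3, S), g = d A := by
  have hz := col_zero h0
  have hz0 : g 0 0 = 1 := by simp [hz, e]
  have hz' : ∀ i : Fin 7, i ≠ 0 → g i 0 = 0 := fun i hi => by simp [hz, e, hi]
  obtain ⟨hD, -, -⟩ := hg.block_det_eq hc h0
  have hA := hg.block_det_up h0
  rw [hb, add_zero] at hA
  rw [hA] at hD
  obtain ⟨hB, hC⟩ := block_offdiag_eq_zero hc hA hD hb (hg.block_adj_up h0) (hg.block_adj_lo h0)
  have hB' : ∀ i j, g (up i) (lo j) = 0 := fun i j => congrFun (congrFun hB i) j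
  have hC' : ∀ i j, g (lo i) (up j) = 0 := fun i j => congrFun (congrFun hC i) j
  have hAD : block up up g * (block lo lo g)ᵀ = c • 1 := by
    ext i j
    have h := hg 0 (up i) (lo j)
    rw [tri_e_zero_up_lo] at h
    simp only [Matrix.mul_apply, Fin.sum_univ_three, block, Matrix.submatrix_apply,
      Matrix.transpose_apply, Matrix.smul_apply, smul_eq_mul, ← h]
    have a1 := hB' i 0
    have a2 := hB' i 1
    have a3 := hB' i 2
    have b1 := hC' j 0
    have b2 := hC' j 1
    have b3 := hC' j 2
    have c1 := hz' (up i) (by fin_cases i <;> decide)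
    have c2 := hz' (lo j) (by fin_cases j <;> decide)
    generalize up i = r at *
    generalize lo j = s at *
    simp [up, lo] at a1 a2 a3 b1 b2 b3
    simp [tri, minor3, a1, a2, a3, b1, b2, b3, c1, c2, hz0, up, lo]
  have hc1 : c = 1 := by
    have := congrArg Matrix.det hAD
    rw [Matrix.det_mul, Matrix.det_transpose, hA, hD, Matrix.det_smul] at this
    simp at this
    obtain ⟨c, rfl⟩ := hc
    have h' : c * c = c ^ 3 := Units.ext (by simpa using this)
    have : c = 1 := by
      have h'' : c * c * c = c * c * 1 := by rw [mul_one, ← pow_two, ← pow_succ, ← h', pow_two]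
      exact mul_left_cancel h''
    simp [this]
  subst hc1
  have hp : ∀ j, g 0 (up j) = 0 := by
    -- Expanding the determinant of the first row together with two rows of `A` produces exactly the
    -- product with the adjugate.
    have hv : (fun j => g 0 (up j)) ᵥ* (block up up g).adjugate = 0 := by
      ext j
      have h := hg 0 (up (j + 1)) (up (j + 2))
      rw [show tri (e S 0) (e S (up (j + 1))) (e S (up (j + 2))) = 0 by
        fin_cases j <;> simp [tri, minor3, e], mul_zero] at h
      have a1 : ∀ i, g (up i) 4 = 0 := fun i => hB' i 0
      have a2 : ∀ i, g (up i) 5 = 0 := fun i => hB' i 1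
      have a3 : ∀ i, g (up i) 6 = 0 := fun i => hB' i 2
      simp only [tri, minor3, a1, a2, a3] at h
      simp only [Matrix.vecMul, dotProduct, Fin.sum_univ_three, Matrix.adjugate_fin_three, block,
        Matrix.submatrix_apply]
      have c1 := hz' 1 (by decide)
      have c2 := hz' 2 (by decide)
      have c3 := hz' 3 (by decide)
      fin_cases j <;> simp [up, c1, c2, c3] at h ⊢ <;> linear_combination h
    have := congrArg (· ᵥ* block up up g) hv
    simp only [Matrix.vecMul_vecMul, Matrix.adjugate_mul, hA, one_smul, Matrix.vecMul_one,
      Matrix.zero_vecMul] at this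
    exact fun j => congrFun this j
  have hp' : ∀ j, g 0 (lo j) = 0 := by
    have hv : (fun j => g 0 (lo j)) ᵥ* (block lo lo g).adjugate = 0 := by
      ext j
      have h := hg 0 (lo (j + 1)) (lo (j + 2))
      rw [show tri (e S 0) (e S (lo (j + 1))) (e S (lo (j + 2))) = 0 by
        fin_cases j <;> simp [tri, minor3, e], mul_zero] at h
      have a1 : ∀ i, g (lo i) 1 = 0 := fun i => hC' i 0
      have a2 : ∀ i, g (lo i) 2 = 0 := fun i => hC' i 1
      have a3 : ∀ i, g (lo i) 3 = 0 := fun i => hC' i 2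
      simp only [tri, minor3, a1, a2, a3] at h
      simp only [Matrix.vecMul, dotProduct, Fin.sum_univ_three, Matrix.adjugate_fin_three, block,
        Matrix.submatrix_apply]
      have c1 := hz' 4 (by decide)
      have c2 := hz' 5 (by decide)
      have c3 := hz' 6 (by decide)
      fin_cases j <;> simp [lo, c1, c2, c3] at h ⊢ <;> linear_combination h
    have := congrArg (· ᵥ* block lo lo g) hv
    simp only [Matrix.vecMul_vecMul, Matrix.adjugate_mul, hD, one_smul, Matrix.vecMul_one,
      Matrix.zero_vecMul] at this
    exact fun j => congrFun this j
  refine ⟨rfl, ⟨block up up g, hA⟩, ?_⟩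
  have hDA : block lo lo g = (block up up g).adjugateᵀ := by
    rw [one_smul] at hAD
    have := congrArg (fun M => ((block up up g).adjugate * M)ᵀ) hAD
    simpa [← Matrix.mul_assoc, Matrix.adjugate_mul, hA] using this
  have hDA' : ∀ i j, g (lo i) (lo j) = (block up up g).adjugate j i :=
    fun i j => congrFun (congrFun hDA i) j
  exact eq_d hz hp hp' hB' hC' (fun _ _ => rfl) fun i j => hDA' i j

/-- Here the diagonal blocks vanish, and the alternating pairing of the two halves acquires a sign:
`B ᵗC = -c`, whence `c² = -c³`. -/
theorem IsSimil.of_diag_det (hg : IsSimil g c) (hc : IsUnit c) (h0 : g *ᵥ e S 0 = e S 0)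
    (ha : (block up up g).det = 0) : c = -1 := by
  have hz := col_zero h0
  have hz0 : g 0 0 = 1 := by simp [hz, e]
  have hz' : ∀ i : Fin 7, i ≠ 0 → g i 0 = 0 := fun i hi => by simp [hz, e, hi]
  obtain ⟨hD, hC, -⟩ := hg.block_det_eq hc h0
  have hB := hg.block_det_up h0
  rw [ha, zero_add] at hB
  rw [hB] at hC
  have h3 := hg.block_adj_up h0
  have h4 := hg.block_adj_lo h0
  -- Exchanging the two block rows reduces this to the case of vanishing off-diagonal determinants.
  obtain ⟨hD0, hA0⟩ := block_offdiag_eq_zero (A := block lo up g) (B := block lo lo g)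
    (C := block up up g) (D := block up lo g) hc hC hB (by rw [hD, ha]) h4 h3
  have hA' : ∀ i j, g (up i) (up j) = 0 := fun i j => congrFun (congrFun hA0 i) j
  have hD' : ∀ i j, g (lo i) (lo j) = 0 := fun i j => congrFun (congrFun hD0 i) j
  have hBC : block up lo g * (block lo up g)ᵀ = -(c • 1) := by
    ext i j
    have h := hg 0 (up i) (lo j)
    rw [tri_e_zero_up_lo] at h
    simp only [Matrix.mul_apply, Fin.sum_univ_three, block, Matrix.submatrix_apply,
      Matrix.transpose_apply, Matrix.neg_apply, Matrix.smul_apply, smul_eq_mul, ← h]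
    have a1 := hA' i 0
    have a2 := hA' i 1
    have a3 := hA' i 2
    have b1 := hD' j 0
    have b2 := hD' j 1
    have b3 := hD' j 2
    have c1 := hz' (up i) (by fin_cases i <;> decide)
    have c2 := hz' (lo j) (by fin_cases j <;> decide)
    generalize up i = r at *
    generalize lo j = s at *
    simp [up, lo] at a1 a2 a3 b1 b2 b3
    simp [tri, minor3, a1, a2, a3, b1, b2, b3, c1, c2, hz0, up, lo]
    ring
  have := congrArg Matrix.det hBC
  rw [Matrix.det_mul, Matrix.det_transpose, hB, hC, Matrix.det_neg, Matrix.det_smul] at this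
  simp at this
  obtain ⟨c, rfl⟩ := hc
  have h' : c * c = c * c * -c := Units.ext (by push_cast; linear_combination this)
  have : 1 = -c := mul_left_cancel (a := c * c) (by rw [mul_one, ← h'])
  have : c = -1 := by rw [this, neg_neg]
  simp [this]

end Fixator


/-! ### The matrices `d(A)` and the exchange `τ` -/

section BlockDiagonal

variable {S : Type u} [CommRing S]

theorem sum_eq_blocks (f : Fin 7 → S) :
    ∑ i, f i = f 0 + (∑ i, f (up i) + ∑ i, f (lo i)) := by
  simp [Fin.sum_univ_succ]
  ring

theorem d_col_zero (A : SL(3, S)) : d A *ᵥ e S 0 = e S 0 := by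
  ext i
  simp only [e, Matrix.mulVec_single_one, Matrix.col_apply]
  rcases eq_zero_or_up_or_lo i with rfl | ⟨i, rfl⟩ | ⟨i, rfl⟩
  · simp [d_zero_zero]
  · rw [d_up_zero]; fin_cases i <;> simp
  · rw [d_lo_zero]; fin_cases i <;> simp

theorem d_one : d (1 : SL(3, S)) = 1 := by
  ext i j
  simp only [d, inv_one, Matrix.SpecialLinearGroup.coe_one]
  fin_cases i <;> fin_cases j <;> simp

theorem d_mul (A B : SL(3, S)) : d (A * B) = d A * d B := by
  symm
  apply eq_d
  · intro i
    have : (d A * d B) *ᵥ e S 0 = e S 0 := by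
      rw [← Matrix.mulVec_mulVec, d_col_zero, d_col_zero]
    exact col_zero this i
  all_goals
    intros
    simp only [Matrix.mul_apply, sum_eq_blocks, d_zero_zero, d_zero_up, d_zero_lo, d_up_zero,
      d_lo_zero, d_up_up, d_up_lo, d_lo_up, d_lo_lo, Matrix.SpecialLinearGroup.coe_mul, mul_inv_rev,
      mul_zero, zero_mul, Finset.sum_const_zero, add_zero, zero_add, mul_comm]

theorem d_map {S' : Type u} [CommRing S'] (f : S →+* S') (A : SL(3, S)) :
    (d A).map f = d (Matrix.SpecialLinearGroup.map f A) := by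
  apply eq_d
  · intro i
    rw [Matrix.map_apply, col_zero (d_col_zero A), ← comp_e f]
    rfl
  all_goals
    intros
    simp only [Matrix.map_apply, d_zero_up, d_zero_lo, d_up_up, d_up_lo, d_lo_up, d_lo_lo, map_zero,
      ← map_inv, Matrix.SpecialLinearGroup.map_apply_coe, RingHom.mapMatrix_apply]

theorem d_injective : Function.Injective (d : SL(3, S) → Matrix (Fin 7) (Fin 7) S) := by
  intro A B h
  ext i j
  rw [← d_up_up, h, d_up_up]

theorem vecMul_d_zero (A : SL(3, S)) (x : Fin 7 → S) : (x ᵥ* d A) 0 = x 0 := by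
  simp [Matrix.vecMul, dotProduct, sum_eq_blocks, d_zero_zero, d_up_zero, d_lo_zero, -Matrix.cons_val]

theorem vecMul_d_up (A : SL(3, S)) (x : Fin 7 → S) : (x ᵥ* d A) ∘ up = (x ∘ up) ᵥ* A.1 := by
  ext j
  simp only [Matrix.vecMul, dotProduct, sum_eq_blocks, d_zero_up, d_up_up, d_lo_up,
    Function.comp_apply, mul_zero, Finset.sum_const_zero, add_zero, zero_add]

theorem vecMul_d_lo (A : SL(3, S)) (x : Fin 7 → S) :
    (x ᵥ* d A) ∘ lo = (x ∘ lo) ᵥ* (A⁻¹).1ᵀ := by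
  ext j
  simp only [Matrix.vecMul, dotProduct, sum_eq_blocks, d_zero_lo, d_up_lo, d_lo_lo,
    Function.comp_apply, mul_zero, Finset.sum_const_zero, zero_add, Matrix.transpose_apply]

theorem tri_eq_blocks (x y z : Fin 7 → S) : tri x y z =
    Matrix.det (Matrix.of ![x ∘ up, y ∘ up, z ∘ up]) +
    Matrix.det (Matrix.of ![x ∘ lo, y ∘ lo, z ∘ lo]) +
    (x 0 * ((y ∘ up) ⬝ᵥ (z ∘ lo) - (z ∘ up) ⬝ᵥ (y ∘ lo)) -
      y 0 * ((x ∘ up) ⬝ᵥ (z ∘ lo) - (z ∘ up) ⬝ᵥ (x ∘ lo)) +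
      z 0 * ((x ∘ up) ⬝ᵥ (y ∘ lo) - (y ∘ up) ⬝ᵥ (x ∘ lo))) := by
  simp [tri, minor3, Matrix.det_fin_three, dotProduct, Fin.sum_univ_three]
  ring

theorem det_of_vecMul (x y z : Fin 3 → S) (A : Matrix (Fin 3) (Fin 3) S) :
    Matrix.det (Matrix.of ![x ᵥ* A, y ᵥ* A, z ᵥ* A]) =
      Matrix.det (Matrix.of ![x, y, z]) * A.det := by
  rw [← Matrix.det_mul]
  congr 1
  ext i j
  fin_cases i <;> rfl

theorem isSimil_of_tri_vecMul {g : Matrix (Fin 7) (Fin 7) S} {c : S}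
    (h : ∀ x y z, tri (x ᵥ* g) (y ᵥ* g) (z ᵥ* g) = c * tri x y z) : IsSimil g c := by
  intro i j l
  rw [← h, e_vecMul, e_vecMul, e_vecMul]

theorem isSimil_d (A : SL(3, S)) : IsSimil (d A) 1 := by
  refine isSimil_of_tri_vecMul fun x y z => ?_
  have key : ∀ u v : Fin 3 → S, (u ᵥ* A.1) ⬝ᵥ (v ᵥ* (A⁻¹).1ᵀ) = u ⬝ᵥ v := by
    intro u v
    rw [Matrix.vecMul_transpose, Matrix.dotProduct_mulVec, Matrix.vecMul_vecMul,
      ← Matrix.SpecialLinearGroup.coe_mul, mul_inv_cancel, Matrix.SpecialLinearGroup.coe_one,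
      Matrix.vecMul_one]
  rw [tri_eq_blocks, tri_eq_blocks]
  simp only [vecMul_d_up, vecMul_d_lo, vecMul_d_zero, key, det_of_vecMul, Matrix.det_transpose,
    A.2, (A⁻¹).2, mul_one, one_mul]

/-- The element exchanging the two isotropic subspaces, with signs given by `Λ`. -/
def tau (S : Type u) [CommRing S] : Matrix (Fin 7) (Fin 7) S :=
  !![1, 0, 0, 0, 0, 0, 0;
     0, 0, 0, 0, 1, 0, 0;
     0, 0, 0, 0, 0, 1, 0;
     0, 0, 0, 0, 0, 0, -1;
     0, 1, 0, 0, 0, 0, 0;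
     0, 0, 1, 0, 0, 0, 0;
     0, 0, 0, -1, 0, 0, 0]

theorem tau_zero_zero : tau S 0 0 = 1 := rfl

theorem tau_zero_up (j : Fin 3) : tau S 0 (up j) = 0 := by fin_cases j <;> rfl

theorem tau_zero_lo (j : Fin 3) : tau S 0 (lo j) = 0 := by fin_cases j <;> rfl

theorem tau_up_zero (i : Fin 3) : tau S (up i) 0 = 0 := by fin_cases i <;> rfl

theorem tau_lo_zero (i : Fin 3) : tau S (lo i) 0 = 0 := by fin_cases i <;> rfl

theorem tau_up_up (i j : Fin 3) : tau S (up i) (up j) = 0 := by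
  fin_cases i <;> fin_cases j <;> rfl

theorem tau_lo_lo (i j : Fin 3) : tau S (lo i) (lo j) = 0 := by
  fin_cases i <;> fin_cases j <;> rfl

theorem tau_up_lo (i j : Fin 3) : tau S (up i) (lo j) = Lam S i j := by
  fin_cases i <;> fin_cases j <;> rfl

theorem tau_lo_up (i j : Fin 3) : tau S (lo i) (up j) = Lam S i j := by
  fin_cases i <;> fin_cases j <;> rfl

theorem Lam_mul_Lam : Lam S * Lam S = 1 := by
  ext i j
  fin_cases i <;> fin_cases j <;> simp [Lam]

theorem Lam_transpose : (Lam S)ᵀ = Lam S := Matrix.diagonal_transpose _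

/-- Comparing the upper right blocks gives `Λ ᵗB⁻¹ = A Λ`, which is the condition on the right. The
lower left blocks give `Λ B = ᵗA⁻¹ Λ`, an equivalent condition by transposition and `Λ² = 1`. -/
theorem tau_mul_d_iff (A B : SL(3, S)) :
    tau S * d B = d A * tau S ↔ A.1 * Lam S * B.1ᵀ = Lam S := by
  have hA : A.1 * (A⁻¹).1 = 1 := by
    rw [← Matrix.SpecialLinearGroup.coe_mul, mul_inv_cancel, Matrix.SpecialLinearGroup.coe_one]
  have hB : (B⁻¹).1 * B.1 = 1 := by
    rw [← Matrix.SpecialLinearGroup.coe_mul, inv_mul_cancel, Matrix.SpecialLinearGroup.coe_one]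
  constructor
  · intro h
    have h1 : Lam S * (B⁻¹).1ᵀ = A.1 * Lam S := by
      ext i j
      have := congrFun (congrFun h (up i)) (lo j)
      simpa only [Matrix.mul_apply, sum_eq_blocks, d_zero_lo, d_up_zero, d_up_up, d_up_lo,
        d_lo_lo, tau_up_zero, tau_zero_lo, tau_up_up, tau_up_lo, tau_lo_lo, mul_zero, zero_mul,
        Finset.sum_const_zero, add_zero, zero_add, Matrix.transpose_apply] using this
    rw [← h1, Matrix.mul_assoc, ← Matrix.transpose_mul]
    have hB' : B.1 * (B⁻¹).1 = 1 := mul_eq_one_comm.mp hB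
    rw [hB', Matrix.transpose_one, Matrix.mul_one]
  · intro h
    have h1 : Lam S * (B⁻¹).1ᵀ = A.1 * Lam S := by
      conv_lhs => rw [← h]
      rw [Matrix.mul_assoc, ← Matrix.transpose_mul, hB, Matrix.transpose_one, Matrix.mul_one]
    have h2 : Lam S * B.1 = (A⁻¹).1ᵀ * Lam S := by
      have h3 : (A.1 * Lam S) * (B.1ᵀ * Lam S) = 1 := by
        rw [← Matrix.mul_assoc, h, Lam_mul_Lam]
      have h4 := congrArg Matrix.transpose (mul_eq_one_comm.mp h3)
      simp only [Matrix.transpose_mul, Matrix.transpose_transpose, Lam_transpose,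
        Matrix.transpose_one, Matrix.mul_assoc] at h4
      have h5 := congrArg (fun M => (A⁻¹).1ᵀ * (Lam S * M)) h4
      have hA' : (A⁻¹).1ᵀ * A.1ᵀ = 1 := by rw [← Matrix.transpose_mul, hA, Matrix.transpose_one]
      simp only [← Matrix.mul_assoc, Lam_mul_Lam, Matrix.one_mul, hA', Matrix.mul_one] at h5
      exact h5
    have h1' := fun i j => congrFun (congrFun h1 i) j
    have h2' := fun i j => congrFun (congrFun h2 i) j
    simp only [Matrix.mul_apply, Matrix.transpose_apply] at h1' h2'
    ext i j
    rcases eq_zero_or_up_or_lo i with rfl | ⟨i, rfl⟩ | ⟨i, rfl⟩ <;>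
    rcases eq_zero_or_up_or_lo j with rfl | ⟨j, rfl⟩ | ⟨j, rfl⟩ <;>
    simp only [Matrix.mul_apply, sum_eq_blocks, d_zero_zero, d_zero_up, d_zero_lo, d_up_zero,
      d_lo_zero, d_up_up, d_up_lo, d_lo_up, d_lo_lo, tau_zero_zero, tau_zero_up, tau_zero_lo,
      tau_up_zero, tau_lo_zero, tau_up_up, tau_lo_lo, tau_up_lo, tau_lo_up, mul_zero, zero_mul,
      Finset.sum_const_zero, add_zero, zero_add, h1', h2']

end BlockDiagonal

/-! ### The matrix `g_α` as a similitude, and its conjugate -/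

section GAlpha

variable {K : Type u} [Field K]

/-- As `σ α = -α`, this identifies `τ` with the cocycle value `g_α⁻¹ g_α^σ` that governs the
descent. -/
theorem gMat_neg (α : K) : gMat (-α) = gMat α * tau K := by
  ext i j
  fin_cases i <;> fin_cases j <;> simp [gMat, tau, Matrix.mul_apply, Fin.sum_univ_succ, neg_div]

theorem vecMul_gMat (α : K) (x : Fin 7 → K) : x ᵥ* gMat α =
    ![α ^ 2 / 2 * x 1 - x 4 / 2, -α * x 0 + α ^ 2 / 2 * x 1 + x 4 / 2,
      α / 2 * x 2 + x 3 / 2 - α / 2 * x 5 + α ^ 2 / 2 * x 6,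
      -α / 2 * x 2 + x 3 / 2 - α / 2 * x 5 - α ^ 2 / 2 * x 6,
      α * x 0 + α ^ 2 / 2 * x 1 + x 4 / 2,
      -α / 2 * x 2 + x 3 / 2 + α / 2 * x 5 + α ^ 2 / 2 * x 6,
      -α / 2 * x 2 - x 3 / 2 - α / 2 * x 5 + α ^ 2 / 2 * x 6] := by
  ext i
  fin_cases i <;> simp [Matrix.vecMul, dotProduct, gMat, Fin.sum_univ_succ] <;> ring

theorem isSimil_gMat [CharZero K] (α : K) : IsSimil (gMat α) (α ^ 3) := by
  refine isSimil_of_tri_vecMul fun x y z => ?_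
  rw [vecMul_gMat, vecMul_gMat, vecMul_gMat]
  simp only [tri, minor3, Matrix.cons_val]
  ring

end GAlpha


/-! ### Conjugation by `g_α`: from the stabilizer of `w_α` to that of `w` -/

section ConjBy

variable {K S : Type u} [Field K] [CommRing S]

/-- The element `g_α d(A) g_α⁻¹` over a `K`-algebra with structure map `ι`. -/
noncomputable def conjBy (α : K) (ι : K →+* S) (A : SL(3, S)) : Matrix (Fin 7) (Fin 7) S :=
  (gMat α).map ι * d A * ((gMat α)⁻¹).map ι

theorem conjugate_eq_conjBy {k : Type u} [Field k] [Algebra k K] (α : K) {R : Type u} [CommRing R]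
    [Algebra k R] (A : SL(3, R ⊗[k] K)) : conjugate α A =
      conjBy α (Algebra.TensorProduct.includeRight : K →ₐ[k] R ⊗[k] K).toRingHom A :=
  rfl

theorem conjBy_map {S' : Type u} [CommRing S'] (f : S →+* S') (α : K) (ι : K →+* S)
    (A : SL(3, S)) :
    (conjBy α ι A).map f = conjBy α (f.comp ι) (Matrix.SpecialLinearGroup.map f A) := by
  rw [conjBy, conjBy, Matrix.map_mul, Matrix.map_mul, d_map, Matrix.map_map, Matrix.map_map]
  rfl

variable [CharZero K] {α : K} (hα : α ≠ 0) (ι : K →+* S)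
include hα

theorem gMat_inv_mul : (gMat α)⁻¹ * gMat α = 1 := mul_eq_one_comm.mp (gMat_mul_inv α hα)

theorem map_gMat_mul_inv : (gMat α).map ι * ((gMat α)⁻¹).map ι = 1 := by
  rw [← Matrix.map_mul, gMat_mul_inv α hα, Matrix.map_one _ (map_zero ι) (map_one ι)]

theorem map_gMat_inv_mul : ((gMat α)⁻¹).map ι * (gMat α).map ι = 1 :=
  mul_eq_one_comm.mp (map_gMat_mul_inv hα ι)

theorem conjBy_one : conjBy α ι 1 = 1 := by
  rw [conjBy, d_one, mul_one, map_gMat_mul_inv hα]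

theorem conjBy_mul (A B : SL(3, S)) : conjBy α ι (A * B) = conjBy α ι A * conjBy α ι B := by
  have h := map_gMat_inv_mul hα ι
  calc conjBy α ι (A * B) = (gMat α).map ι * d A * 1 * d B * ((gMat α)⁻¹).map ι := by
        simp only [conjBy, d_mul, mul_one, Matrix.mul_assoc]
    _ = _ := by
        rw [← h]
        simp only [conjBy, Matrix.mul_assoc]

theorem eq_conjBy_iff (g : Matrix (Fin 7) (Fin 7) S) (A : SL(3, S)) :
    g = conjBy α ι A ↔ ((gMat α)⁻¹).map ι * g * (gMat α).map ι = d A := by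
  have h := map_gMat_inv_mul hα ι
  have h' := map_gMat_mul_inv hα ι
  constructor
  · rintro rfl
    calc _ = (((gMat α)⁻¹).map ι * (gMat α).map ι) * d A *
          (((gMat α)⁻¹).map ι * (gMat α).map ι) := by simp only [conjBy, Matrix.mul_assoc]
      _ = _ := by rw [h, Matrix.one_mul, Matrix.mul_one]
  · intro hg
    rw [conjBy, ← hg]
    calc g = ((gMat α).map ι * ((gMat α)⁻¹).map ι) * g *
          ((gMat α).map ι * ((gMat α)⁻¹).map ι) := by rw [h', Matrix.one_mul, Matrix.mul_one]
      _ = _ := by simp only [Matrix.mul_assoc]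

theorem conjBy_injective : Function.Injective (conjBy α ι) := by
  intro A B h
  apply d_injective
  rw [← (eq_conjBy_iff hα ι _ A).mp rfl, h, (eq_conjBy_iff hα ι _ B).mp rfl]

theorem isSimil_map_gMat_inv :
    IsSimil (((gMat α)⁻¹).map ι) (ι ((Units.mk0 α hα ^ 3)⁻¹ : Kˣ)) := by
  apply IsSimil.map
  refine IsSimil.inv (g := gMat α) ?_ (gMat_inv_mul hα)
  simpa using isSimil_gMat α

theorem IsSimil.conj {g : Matrix (Fin 7) (Fin 7) S} {c : S} (hg : IsSimil g c) :
    IsSimil ((gMat α).map ι * g * ((gMat α)⁻¹).map ι) c ∧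
      IsSimil (((gMat α)⁻¹).map ι * g * (gMat α).map ι) c := by
  have h1 := (isSimil_gMat α).map ι
  have h2 := isSimil_map_gMat_inv hα ι
  have h3 : ι (α ^ 3) * ι ((Units.mk0 α hα ^ 3)⁻¹ : Kˣ) = 1 := by
    rw [← map_mul, ← map_one ι]
    congr 1
    simpa using mul_inv_cancel₀ (pow_ne_zero 3 hα)
  constructor
  · convert (h1.mul hg).mul h2 using 1
    linear_combination -c * h3
  · convert (h2.mul hg).mul h1 using 1
    linear_combination -c * h3

theorem isSimil_conjBy (A : SL(3, S)) : IsSimil (conjBy α ι A) 1 :=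
  ((isSimil_d A).conj hα ι).1

omit [CharZero K] hα in
theorem map_wVec : ι ∘ wVec α = (gMat α).map ι *ᵥ e S 0 := by
  rw [wVec, ← comp_e ι]
  ext i
  exact RingHom.map_mulVec ι (gMat α) (e K 0) i

theorem conjBy_mulVec (A : SL(3, S)) : conjBy α ι A *ᵥ (ι ∘ wVec α) = ι ∘ wVec α := by
  rw [map_wVec, conjBy, Matrix.mulVec_mulVec, Matrix.mul_assoc, map_gMat_inv_mul hα,
    Matrix.mul_one, ← Matrix.mulVec_mulVec, d_col_zero]

theorem conj_mulVec {g : Matrix (Fin 7) (Fin 7) S} (hg : g *ᵥ (ι ∘ wVec α) = ι ∘ wVec α) :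
    (((gMat α)⁻¹).map ι * g * (gMat α).map ι) *ᵥ e S 0 = e S 0 := by
  rw [← Matrix.mulVec_mulVec, ← map_wVec, ← Matrix.mulVec_mulVec, hg, map_wVec,
    Matrix.mulVec_mulVec, map_gMat_inv_mul hα, Matrix.one_mulVec]

theorem IsSimil.eq_one_or_neg_one [IsDomain S] {g : Matrix (Fin 7) (Fin 7) S} {c : S}
    (hg : IsSimil g c) (hc : IsUnit c) (hw : g *ᵥ (ι ∘ wVec α) = ι ∘ wVec α) :
    c = 1 ∨ c = -1 := by
  have h := (hg.conj hα ι).2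
  have h0 := conj_mulVec hα ι hw
  rcases mul_eq_zero.mp (h.block_det_eq hc h0).2.2 with ha | hb
  · exact Or.inr (h.of_diag_det hc h0 ha)
  · exact Or.inl (h.of_offdiag_det hc h0 hb).1

/-- `S` may have nilpotents and zero divisors, so `ab = 0` does not decide which determinant
vanishes. The hypothesis on `c` settles it modulo every prime, leaving `b` nilpotent; it is then
zero because `b(b - c) = 0` with `b - c` a unit. -/
theorem IsSimil.exists_eq_conjBy {g : Matrix (Fin 7) (Fin 7) S} {c : S}
    (hg : IsSimil g c) (hc : IsUnit c) (hw : g *ᵥ (ι ∘ wVec α) = ι ∘ wVec α)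
    (hc1 : ∀ Q : Ideal S, Q.IsPrime → c - 1 ∈ Q) :
    ∃ A : SL(3, S), g = conjBy α ι A := by
  have h := (hg.conj hα ι).2
  have h0 := conj_mulVec hα ι hw
  simp only [eq_conjBy_iff hα ι]
  set g' := ((gMat α)⁻¹).map ι * g * (gMat α).map ι
  have hab := (h.block_det_eq hc h0).2.2
  have hadd := h.block_det_up h0
  have hnil : IsNilpotent (block up lo g').det := by
    rw [nilpotent_iff_mem_prime]
    intro Q hQ
    -- If `a` were in `Q`, the multiplier modulo `Q` would be both `-1` and `1`, although `2` is
    -- invertible in `K`.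
    refine (hQ.mem_or_mem_of_mul_eq_zero hab).resolve_left fun ha => ?_
    have h1 := h.map (Ideal.Quotient.mk Q)
    have h2 : g'.map (Ideal.Quotient.mk Q) *ᵥ e (S ⧸ Q) 0 = e (S ⧸ Q) 0 := by
      rw [← comp_e (Ideal.Quotient.mk Q)]
      ext i
      have := RingHom.map_mulVec (Ideal.Quotient.mk Q) g' (e S 0) i
      rw [h0] at this
      exact this.symm
    have h3 : (block up up (g'.map (Ideal.Quotient.mk Q))).det = 0 := by
      rw [← Ideal.Quotient.eq_zero_iff_mem.mpr ha, RingHom.map_det]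
      rfl
    have h4 := h1.of_diag_det (hc.map _) h2 h3
    have h5 := Ideal.Quotient.eq_zero_iff_mem.mpr (hc1 Q hQ)
    rw [map_sub, map_one, h4] at h5
    have h6 : ((Ideal.Quotient.mk Q).comp ι) 2 = 0 := by
      rw [map_ofNat]
      linear_combination -h5
    exact two_ne_zero ((map_eq_zero _).mp h6)
  have hb : (block up lo g').det = 0 := by
    have hu : IsUnit ((block up lo g').det - c) := by
      rw [sub_eq_add_neg]
      exact hnil.isUnit_add_right_of_commute hc.neg (Commute.all _ _)
    apply (hu.mul_left_eq_zero).mp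
    linear_combination (block up lo g').det * hadd - hab
  exact (h.of_offdiag_det hc h0 hb).2

end ConjBy


/-! ### Galois descent from `R(α)` to `R` -/

section Descent

variable {k K : Type u} [Field k] [Field K] [Algebra k K] {α : K}

theorem exists_eq_add_mul (hα2 : α ^ 2 ∈ Set.range (algebraMap k K)) (hK : k⟮α⟯ = ⊤) (y : K) :
    ∃ a b : k, y = algebraMap k K a + algebraMap k K b * α := by
  obtain ⟨t, ht⟩ := hα2
  have hint : IsIntegral k α := by
    refine IsIntegral.of_pow (n := 2) (by norm_num) ?_
    rw [← ht]
    exact isIntegral_algebraMap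
  have hy : y ∈ Algebra.adjoin k {α} := by
    rw [← IntermediateField.adjoin_simple_toSubalgebra_of_isAlgebraic hint.isAlgebraic, hK]
    trivial
  induction hy using Algebra.adjoin_induction with
  | mem x hx =>
    rw [Set.mem_singleton_iff.mp hx]
    exact ⟨0, 1, by simp⟩
  | algebraMap r => exact ⟨r, 0, by simp⟩
  | add x y _ _ hx hy =>
    obtain ⟨a, b, rfl⟩ := hx
    obtain ⟨a', b', rfl⟩ := hy
    exact ⟨a + a', b + b', by simp only [map_add]; ring⟩
  | mul x y _ _ hx hy =>
    obtain ⟨a, b, rfl⟩ := hx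
    obtain ⟨a', b', rfl⟩ := hy
    refine ⟨a * a' + b * b' * t, a * b' + a' * b, ?_⟩
    simp only [map_add, map_mul, ht]
    ring

theorem apply_eq_neg (hα2 : α ^ 2 ∈ Set.range (algebraMap k K)) (hK : k⟮α⟯ = ⊤)
    {σ : K ≃ₐ[k] K} (hσ : σ ≠ AlgEquiv.refl) : σ α = -α := by
  have h : σ α ^ 2 = α ^ 2 := by
    obtain ⟨t, ht⟩ := hα2
    rw [← map_pow, ← ht, σ.commutes]
  refine (sq_eq_sq_iff_eq_or_eq_neg.mp h).resolve_left fun h1 => hσ ?_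
  ext y
  obtain ⟨a, b, rfl⟩ := exists_eq_add_mul hα2 hK y
  simp [h1]

/-- Every element is `r ⊗ 1 + s ⊗ α`, and conjugation changes the sign of the second term; a fixed
element has `2 (s ⊗ α) = 0`. -/
theorem exists_includeLeft_of_conj_eq [CharZero k] (hα2 : α ^ 2 ∈ Set.range (algebraMap k K))
    (hK : k⟮α⟯ = ⊤) {σ : K ≃ₐ[k] K} (hσα : σ α = -α) {R : Type u} [CommRing R] [Algebra k R]
    {x : R ⊗[k] K} (hx : conj σ R x = x) :
    ∃ r : R, (Algebra.TensorProduct.includeLeft : R →ₐ[k] R ⊗[k] K) r = x := by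
  have key : ∀ x : R ⊗[k] K, ∃ r s : R, x = r ⊗ₜ 1 + s ⊗ₜ α := by
    intro x
    induction x with
    | zero => exact ⟨0, 0, by simp⟩
    | tmul r y =>
      obtain ⟨a, b, rfl⟩ := exists_eq_add_mul hα2 hK y
      refine ⟨a • r, b • r, ?_⟩
      rw [TensorProduct.tmul_add, TensorProduct.smul_tmul, TensorProduct.smul_tmul,
        Algebra.algebraMap_eq_smul_one, ← Algebra.smul_def]
    | add x y hx hy =>
      obtain ⟨r, s, rfl⟩ := hx
      obtain ⟨r', s', rfl⟩ := hy
      exact ⟨r + r', s + s', by simp only [TensorProduct.add_tmul]; abel⟩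
  obtain ⟨r, s, rfl⟩ := key x
  have h : (2 : k) • (s ⊗ₜ[k] α : R ⊗[k] K) = 0 := by
    simp only [conj, map_add, Algebra.TensorProduct.map_tmul, AlgHom.coe_id, id, map_one,
      AlgEquiv.coe_toAlgHom, hσα, TensorProduct.tmul_neg] at hx
    rw [two_smul]
    have := add_left_cancel hx
    rw [← eq_neg_iff_add_eq_zero, this]
  have h0 : (s ⊗ₜ[k] α : R ⊗[k] K) = 0 := (smul_eq_zero_iff_right two_ne_zero).mp h
  exact ⟨r, by simp [h0]⟩

theorem includeLeft_injective (R : Type u) [CommRing R] [Algebra k R] : Function.Injective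
    (Algebra.TensorProduct.includeLeft : R →ₐ[k] R ⊗[k] K) :=
  Algebra.TensorProduct.includeLeft_injective (S := k) (algebraMap k K).injective

theorem extend_injective (R : Type u) [CommRing R] [Algebra k R] :
    Function.Injective (extend k K : GL (Fin 7) R → _) := by
  intro g h hgh
  apply Units.ext
  exact Matrix.map_injective (includeLeft_injective R) hgh

theorem extend_mul {R : Type u} [CommRing R] [Algebra k R] (g h : GL (Fin 7) R) :
    extend k K (g * h) = extend k K g * extend k K h := by
  simp [extend, Matrix.map_mul]

theorem map_conj_extend (σ : K ≃ₐ[k] K) {R : Type u} [CommRing R] [Algebra k R]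
    (g : GL (Fin 7) R) : (extend k K g).map (conj σ R) = extend k K g := by
  ext i j
  simp [extend, conj]

variable [CharZero K]

/-- Along `ι ∘ σ` the matrix `g_α` becomes `g_α τ`, so after cancelling `g_α` the equality says `τ
d(B) τ⁻¹ = d(A)`. In the application `B = A^σ`. -/
theorem conjBy_eq_conjBy_comp_iff (hα : α ≠ 0) {σ : K →+* K} (hσα : σ α = -α) {S : Type u}
    [CommRing S] (ι : K →+* S) (A B : SL(3, S)) :
    conjBy α (ι.comp σ) B = conjBy α ι A ↔ A.1 * Lam S * B.1ᵀ = Lam S := by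
  have hτ : (gMat α).map (ι.comp σ) = (gMat α).map ι * tau S := by
    have h1 : (gMat α).map σ = gMat α * tau K := by
      rw [← gMat_neg, ← hσα]
      ext i j
      fin_cases i <;> fin_cases j <;> simp [gMat, map_ofNat σ 2]
    have h2 : (tau K).map ι = tau S := by
      ext i j
      fin_cases i <;> fin_cases j <;> simp [tau]
    rw [← h2, ← Matrix.map_mul, ← h1, Matrix.map_map]
    rfl
  have h1 := map_gMat_inv_mul hα ι
  have h2 := map_gMat_mul_inv hα (ι.comp σ)
  have h3 := map_gMat_inv_mul hα (ι.comp σ)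
  rw [← tau_mul_d_iff, eq_conjBy_iff hα ι, conjBy]
  rw [hτ] at h2 h3 ⊢
  set g := (gMat α).map ι
  set g' := ((gMat α)⁻¹).map ι
  set h := ((gMat α)⁻¹).map (ι.comp σ)
  have e1 : g' * (g * tau S * d B * h) * g = tau S * d B * (h * g) := by
    calc _ = (g' * g) * (tau S * d B * (h * g)) := by simp only [Matrix.mul_assoc]
      _ = _ := by rw [h1, Matrix.one_mul]
  have e2 : tau S * (h * g) = 1 := mul_eq_one_comm.mp (by rw [Matrix.mul_assoc, h3])
  rw [e1]
  constructor
  · intro H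
    rw [← H]
    calc _ = tau S * d B * (h * (g * tau S)) := by rw [h3, Matrix.mul_one]
      _ = _ := by simp only [Matrix.mul_assoc]
  · intro H
    rw [H, Matrix.mul_assoc, e2, Matrix.mul_one]

theorem map_conj_conjugate_iff (hα : α ≠ 0) {σ : K ≃ₐ[k] K} (hσα : σ α = -α) {R : Type u}
    [CommRing R] [Algebra k R] (A : SL(3, R ⊗[k] K)) :
    (conjugate α A).map (conj σ R) = conjugate α A ↔ A ∈ SU σ R := by
  have hι : (conj σ R).toRingHom.comp
      (Algebra.TensorProduct.includeRight : K →ₐ[k] R ⊗[k] K).toRingHom =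
      (Algebra.TensorProduct.includeRight : K →ₐ[k] R ⊗[k] K).toRingHom.comp
        (σ : K →+* K) := by
    ext x
    simp [conj]
  have h := conjBy_eq_conjBy_comp_iff hα (σ := (σ : K →+* K)) hσα
    (Algebra.TensorProduct.includeRight : K →ₐ[k] R ⊗[k] K).toRingHom A
    (Matrix.SpecialLinearGroup.map (conj σ R).toRingHom A)
  rw [← hι, ← conjBy_map, ← conjugate_eq_conjBy] at h
  exact h

theorem mem_SU_of_extend_eq (hα : α ≠ 0) {σ : K ≃ₐ[k] K} (hσα : σ α = -α) {R : Type u}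
    [CommRing R] [Algebra k R] {A : SL(3, R ⊗[k] K)} {g : GL (Fin 7) R}
    (h : extend k K g = conjugate α A) : A ∈ SU σ R := by
  rw [← map_conj_conjugate_iff hα hσα, ← h, map_conj_extend]

theorem exists_extend_eq [CharZero k] (hα : α ≠ 0) (hα2 : α ^ 2 ∈ Set.range (algebraMap k K))
    (hK : k⟮α⟯ = ⊤) {σ : K ≃ₐ[k] K} (hσα : σ α = -α) {R : Type u}
    [CommRing R] [Algebra k R] {A : SL(3, R ⊗[k] K)} (hA : A ∈ SU σ R) :
    ∃ g : GL (Fin 7) R, extend k K g = conjugate α A := by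
  have key : ∀ B ∈ SU σ R, ∃ M : Matrix (Fin 7) (Fin 7) R,
      M.map (Algebra.TensorProduct.includeLeft : R →ₐ[k] R ⊗[k] K) = conjugate α B := by
    intro B hB
    have h := (map_conj_conjugate_iff hα hσα B).mpr hB
    have h' : ∀ i j, ∃ r : R, (Algebra.TensorProduct.includeLeft : R →ₐ[k] R ⊗[k] K) r =
        conjugate α B i j := fun i j =>
      exists_includeLeft_of_conj_eq hα2 hK hσα (congrFun (congrFun h i) j)
    choose M hM using h'
    exact ⟨Matrix.of M, by ext i j; exact hM i j⟩
  obtain ⟨M, hM⟩ := key A hA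
  -- The inverse is descended separately, so that the descended matrix is invertible over `R`
  -- itself.
  obtain ⟨N, hN⟩ := key A⁻¹ (inv_mem hA)
  have h1 : M * N = 1 := by
    apply Matrix.map_injective (includeLeft_injective (k := k) (K := K) R)
    beta_reduce
    rw [Matrix.map_mul, hM, hN, conjugate_eq_conjBy, conjugate_eq_conjBy, ← conjBy_mul hα,
      mul_inv_cancel, conjBy_one hα, Matrix.map_one _ (map_zero _) (map_one _)]
  exact ⟨⟨M, N, h1, mul_eq_one_comm.mp h1⟩, hM⟩

end Descent


/-! ### The stabilizer of `w_α` under extension of scalars -/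

section Stabilizer

variable {k K : Type u} [Field k] [Field K] [Algebra k K] {α : K} {wα : Fin 7 → k}

theorem mem_stabilizer_iff {R : Type u} [CommRing R] [Algebra k R] (g : GL (Fin 7) R) :
    g ∈ stabilizer wα R ↔ (∃ c : Rˣ, IsSimil (g : Matrix (Fin 7) (Fin 7) R) c) ∧
      (g : Matrix (Fin 7) (Fin 7) R) *ᵥ (algebraMap k R ∘ wα) = algebraMap k R ∘ wα :=
  and_congr (mem_G_iff g) Iff.rfl

theorem comp_wα (hw : ∀ i, algebraMap k K (wα i) = wVec α i) {R S : Type u} [CommRing R]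
    [Algebra k R] [CommRing S] {f : R →+* S} {ι : K →+* S}
    (hf : f.comp (algebraMap k R) = ι.comp (algebraMap k K)) :
    f ∘ algebraMap k R ∘ wα = ι ∘ wVec α := by
  ext i
  have := RingHom.congr_fun hf (wα i)
  simpa [hw] using this

theorem map_mulVec_wVec (hw : ∀ i, algebraMap k K (wα i) = wVec α i) {R S : Type u} [CommRing R]
    [Algebra k R] [CommRing S] {f : R →+* S} {ι : K →+* S}
    (hf : f.comp (algebraMap k R) = ι.comp (algebraMap k K)) {M : Matrix (Fin 7) (Fin 7) R}
    (hM : M *ᵥ (algebraMap k R ∘ wα) = algebraMap k R ∘ wα) :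
    M.map f *ᵥ (ι ∘ wVec α) = ι ∘ wVec α := by
  rw [← comp_wα hw hf]
  ext i
  have := RingHom.map_mulVec f M (algebraMap k R ∘ wα) i
  rw [hM] at this
  exact this.symm

/-- A matrix which becomes `g_α d(A) g_α⁻¹` over some `K`-algebra containing `R` belongs to the
stabilizer. -/
theorem mem_stabilizer_of_map_eq [CharZero K] (hα : α ≠ 0)
    (hw : ∀ i, algebraMap k K (wα i) = wVec α i) {R S : Type u} [CommRing R]
    [Algebra k R] [CommRing S] {f : R →+* S} {ι : K →+* S}
    (hf : f.comp (algebraMap k R) = ι.comp (algebraMap k K)) (hinj : Function.Injective f)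
    {g : GL (Fin 7) R} {A : SL(3, S)}
    (h : (g : Matrix (Fin 7) (Fin 7) R).map f = conjBy α ι A) :
    g ∈ stabilizer wα R := by
  rw [mem_stabilizer_iff]
  refine ⟨⟨1, IsSimil.of_map f hinj ?_⟩, ?_⟩
  · rw [h, Units.val_one, map_one]
    exact isSimil_conjBy hα ι A
  · have h1 := conjBy_mulVec hα ι A
    rw [← h, ← comp_wα hw hf] at h1
    ext i
    apply hinj
    rw [RingHom.map_mulVec]
    exact congrFun h1 i

/-- For a residue field `L` of the stabilizer, `L ⊗ K` need not be a domain; its quotient by a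
maximal ideal is a common extension of `L` and `K` where `ab = 0` can be used. -/
theorem exists_domain (K : Type u) [Field K] [Algebra k K] (L : Type u) [Field L] [Algebra k L] :
    ∃ (D : Type u) (_ : CommRing D) (_ : IsDomain D) (f : L →+* D) (ι : K →+* D),
      f.comp (algebraMap k L) = ι.comp (algebraMap k K) := by
  obtain ⟨Q, hQ⟩ := Ideal.exists_maximal (L ⊗[k] K)
  refine ⟨(L ⊗[k] K) ⧸ Q, inferInstance, inferInstance,
    (Ideal.Quotient.mk Q).comp (Algebra.TensorProduct.includeLeft : L →ₐ[k] L ⊗[k] K).toRingHom,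
    (Ideal.Quotient.mk Q).comp (Algebra.TensorProduct.includeRight : K →ₐ[k] L ⊗[k] K).toRingHom,
    ?_⟩
  ext x
  simp

end Stabilizer

/-! ### The multiplier on the identity component -/

section Component

variable {k : Type u} [Field k]

theorem pointMap_map {n : ℕ} {R S : Type u} [CommRing R] [Algebra k R] [CommRing S] [Algebra k S]
    (f : R →ₐ[k] S) (M : Matrix (Fin n) (Fin n) R) (q : PrimeSpectrum S) :
    pointMap (k := k) (M.map f) q = pointMap (k := k) M (PrimeSpectrum.comap f.toRingHom q) := by
  have h : (MvPolynomial.aeval fun ij : Fin n × Fin n => (M.map f) ij.1 ij.2) =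
      f.comp (MvPolynomial.aeval fun ij : Fin n × Fin n => M ij.1 ij.2) := by
    ext ij
    simp
  rw [pointMap, h]
  rfl

theorem continuous_pointMap {n : ℕ} {R : Type u} [CommRing R] [Algebra k R]
    (M : Matrix (Fin n) (Fin n) R) : Continuous (pointMap (k := k) M) :=
  PrimeSpectrum.continuous_comap _

/-- The polynomial function giving the multiplier on the group `G`. -/
noncomputable def multiplier (k : Type u) [Field k] : MvPolynomial (Fin 7 × Fin 7) k :=
  tri (Matrix.mvPolynomialX (Fin 7) (Fin 7) k 1) (Matrix.mvPolynomialX (Fin 7) (Fin 7) k 2)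
    (Matrix.mvPolynomialX (Fin 7) (Fin 7) k 3)

theorem map_multiplier {R : Type u} [CommRing R] (f : MvPolynomial (Fin 7 × Fin 7) k →+* R)
    {M : Matrix (Fin 7) (Fin 7) R} (hM : (Matrix.mvPolynomialX (Fin 7) (Fin 7) k).map f = M) :
    f (multiplier k) = tri (M 1) (M 2) (M 3) := by
  subst hM
  exact map_tri f _ _ _

theorem aeval_multiplier {R : Type u} [CommRing R] [Algebra k R] (M : Matrix (Fin 7) (Fin 7) R) :
    (MvPolynomial.aeval fun ij : Fin 7 × Fin 7 => M ij.1 ij.2) (multiplier k) =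
      tri (M 1) (M 2) (M 3) :=
  map_multiplier (MvPolynomial.aeval fun ij : Fin 7 × Fin 7 => M ij.1 ij.2).toRingHom
    (by ext i j; simp [Matrix.mvPolynomialX])

variable {K : Type u} [Field K] [Algebra k K] [CharZero K] {α : K} {wα : Fin 7 → k}

theorem multiplier_mem (hα : α ≠ 0) (hw : ∀ i, algebraMap k K (wα i) = wVec α i)
    {p : MatrixSpace k 7} (hp : p ∈ underlyingSpace (stabilizer wα)) :
    multiplier k - 1 ∈ p.asIdeal ∨ multiplier k + 1 ∈ p.asIdeal := by
  obtain ⟨g, hg, hgp⟩ := hp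
  rw [mem_stabilizer_iff] at hg
  obtain ⟨⟨c, hc⟩, hgw⟩ := hg
  have hcm : algebraMap _ p.asIdeal.ResidueField (multiplier k) = c := by
    rw [hc.eq_tri, hgp]
    exact map_multiplier _ rfl
  obtain ⟨D, _, _, f, ι, hf⟩ := exists_domain K p.asIdeal.ResidueField (k := k)
  have h := (hc.map f).eq_one_or_neg_one hα ι (c.isUnit.map f) (map_mulVec_wVec hw hf hgw)
  have hf' := f.injective
  rw [← Ideal.algebraMap_residueField_eq_zero, ← Ideal.algebraMap_residueField_eq_zero, map_sub,
    map_add, map_one, hcm]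
  refine h.imp (fun h => ?_) fun h => ?_
  · rw [hf' (h.trans (map_one f).symm), sub_self]
  · rw [hf' (h.trans (by rw [map_neg, map_one]) : f c = f (-1)), neg_add_cancel]

/-- The component is connected, is covered by the disjoint closed loci where the multiplier is `1`
and `-1`, and meets the first at the identity. -/
theorem multiplier_sub_one_mem (hα : α ≠ 0) (hw : ∀ i, algebraMap k K (wα i) = wVec α i)
    {p : MatrixSpace k 7} (hp : p ∈ connectedComponentIn (underlyingSpace (stabilizer wα))
      (identityPoint k 7)) :
    multiplier k - 1 ∈ p.asIdeal := by
  have h1 : identityPoint k 7 ∈ PrimeSpectrum.zeroLocus {multiplier k - 1} := by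
    rw [PrimeSpectrum.mem_zeroLocus, Set.singleton_subset_iff]
    change (MvPolynomial.aeval fun ij : Fin 7 × Fin 7 => (1 : Matrix (Fin 7) (Fin 7) k) ij.1 ij.2)
      (multiplier k - 1) ∈ (⊥ : Ideal k)
    rw [map_sub, aeval_multiplier, map_one, Ideal.mem_bot]
    simp [tri, minor3]
  have hid : identityPoint k 7 ∈ connectedComponentIn (underlyingSpace (stabilizer wα))
      (identityPoint k 7) := mem_connectedComponentIn (connectedComponentIn_nonempty_iff.mp ⟨p, hp⟩)
  have hpre := isPreconnected_connectedComponentIn (F := underlyingSpace (stabilizer wα))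
    (x := identityPoint k 7)
  have hdisj : Disjoint (PrimeSpectrum.zeroLocus {multiplier k - 1})
      (PrimeSpectrum.zeroLocus {multiplier k + 1}) := by
    rw [Set.disjoint_left]
    intro x hx hx'
    rw [PrimeSpectrum.mem_zeroLocus, Set.singleton_subset_iff] at hx hx'
    have h2 := x.asIdeal.mul_mem_left (MvPolynomial.C (1 / 2)) (x.asIdeal.sub_mem hx' hx)
    have : CharZero k := (algebraMap k K).charZero
    have h3 : (MvPolynomial.C (1 / 2) : MvPolynomial (Fin 7 × Fin 7) k) *
        (multiplier k + 1 - (multiplier k - 1)) = 1 := by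
      have : (MvPolynomial.C (1 / 2) : MvPolynomial (Fin 7 × Fin 7) k) * 2 = 1 := by
        rw [← map_ofNat MvPolynomial.C, ← map_mul, one_div_mul_cancel two_ne_zero, map_one]
      linear_combination this
    rw [h3] at h2
    exact x.isPrime.ne_top ((Ideal.eq_top_iff_one _).mpr h2)
  rcases isPreconnected_iff_subset_of_disjoint_closed.mp hpre _ _
    (PrimeSpectrum.isClosed_zeroLocus {multiplier k - 1})
    (PrimeSpectrum.isClosed_zeroLocus {multiplier k + 1})
    (fun x hx => by
      simpa [PrimeSpectrum.mem_zeroLocus] using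
        multiplier_mem hα hw (connectedComponentIn_subset _ _ hx))
    (by rw [hdisj.inter_eq, Set.inter_empty]) with h | h
  · simpa [PrimeSpectrum.mem_zeroLocus] using h hp
  · exact (Set.disjoint_left.mp hdisj h1 (h hid)).elim

theorem tri_sub_one_mem (hα : α ≠ 0) (hw : ∀ i, algebraMap k K (wα i) = wVec α i)
    {R : Type u} [CommRing R] [Algebra k R] {g : GL (Fin 7) R}
    (hg : g ∈ identityComponent (stabilizer wα) R) (q : PrimeSpectrum R) :
    tri (g.1 1) (g.1 2) (g.1 3) - 1 ∈ q.asIdeal := by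
  have h := multiplier_sub_one_mem hα hw (hg.2 q)
  rw [← aeval_multiplier (k := k), ← map_one (MvPolynomial.aeval (R := k) fun ij : Fin 7 × Fin 7 =>
    g.1 ij.1 ij.2), ← map_sub]
  exact h

theorem exists_conjugate_of_mem_identityComponent (hα : α ≠ 0)
    (hw : ∀ i, algebraMap k K (wα i) = wVec α i)
    {R : Type u} [CommRing R] [Algebra k R] {g : GL (Fin 7) R}
    (hg : g ∈ identityComponent (stabilizer wα) R) :
    ∃ A : SL(3, R ⊗[k] K), extend k K g = conjugate α A := by
  obtain ⟨⟨c, hc⟩, hgw⟩ := (mem_stabilizer_iff g).mp hg.1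
  have hf : (Algebra.TensorProduct.includeLeft : R →ₐ[k] R ⊗[k] K).toRingHom.comp
      (algebraMap k R) =
      (Algebra.TensorProduct.includeRight : K →ₐ[k] R ⊗[k] K).toRingHom.comp
        (algebraMap k K) := by
    ext x
    simp
  refine (hc.map (Algebra.TensorProduct.includeLeft : R →ₐ[k] R ⊗[k] K).toRingHom).exists_eq_conjBy
    hα _ (c.isUnit.map _) (map_mulVec_wVec hw hf hgw) fun Q hQ => ?_
  have h := tri_sub_one_mem hα hw hg (PrimeSpectrum.comap
    (Algebra.TensorProduct.includeLeft : R →ₐ[k] R ⊗[k] K).toRingHom ⟨Q, hQ⟩)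
  rw [← hc.eq_tri] at h
  rw [← map_one (Algebra.TensorProduct.includeLeft : R →ₐ[k] R ⊗[k] K).toRingHom, ← map_sub]
  exact h

end Component


/-! ### A generic element of `SL(3)` over an integral domain -/

section GenericPoint

/-- The coordinate ring of `GL(3)` over `K`. -/
abbrev GL3Ring (K : Type u) [Field K] : Type u :=
  Localization.Away (Matrix.mvPolynomialX (Fin 3) (Fin 3) K).det

variable (K : Type u) [Field K]

theorem isDomain_GL3Ring : IsDomain (GL3Ring K) :=
  IsLocalization.isDomain_localization
    (powers_le_nonZeroDivisors_of_noZeroDivisors (Matrix.det_mvPolynomialX_ne_zero (Fin 3) K))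

/-- There is an element of `SL(3)` over the coordinate ring of `GL(3)` which specializes to every
element of `SL(3)` over a `K`-algebra: the generic matrix with its first row divided by its
determinant. -/
theorem exists_generic_SL3 : ∃ A₀ : SL(3, GL3Ring K),
    ∀ (L : Type u) [CommRing L] [Algebra K L] (A : SL(3, L)), ∃ f : GL3Ring K →ₐ[K] L,
      Matrix.SpecialLinearGroup.map f.toRingHom A₀ = A := by
  let X := Matrix.mvPolynomialX (Fin 3) (Fin 3) K
  let δ : GL3Ring K := IsLocalization.Away.invSelf X.det
  have hδ : algebraMap _ (GL3Ring K) X.det * δ = 1 := IsLocalization.Away.mul_invSelf _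
  let X' : Matrix (Fin 3) (Fin 3) (GL3Ring K) := X.map (algebraMap _ (GL3Ring K))
  have hX' : X'.det = algebraMap _ (GL3Ring K) X.det := (RingHom.map_det _ _).symm
  refine ⟨⟨X'.updateRow 0 (δ • X' 0), ?_⟩, ?_⟩
  · rw [Matrix.det_updateRow_smul, Matrix.updateRow_eq_self, hX', mul_comm, hδ]
  · intro L _ _ A
    let ev : MvPolynomial (Fin 3 × Fin 3) K →ₐ[K] L :=
      MvPolynomial.aeval fun ij : Fin 3 × Fin 3 => A.1 ij.1 ij.2
    have hev : ∀ i j, ev (X i j) = A.1 i j := fun i j => by simp [ev, X, Matrix.mvPolynomialX]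
    -- At a matrix of determinant `1` the division by the determinant has no effect, so evaluation
    -- recovers `A`.
    have hdet : ev X.det = 1 := by
      rw [AlgHom.map_det, ← A.2]
      congr 1
      ext i j
      exact hev i j
    let f : GL3Ring K →ₐ[K] L := IsLocalization.liftAlgHom (M := Submonoid.powers X.det) (f := ev)
      (by
        rintro ⟨_, n, rfl⟩
        simp [hdet])
    have hf : ∀ x, f (algebraMap _ _ x) = ev x := fun x => IsLocalization.lift_eq _ x
    have hfδ : f δ = 1 := by
      have := congrArg f hδ
      rwa [map_mul, hf, hdet, one_mul, map_one] at this
    refine ⟨f, ?_⟩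
    ext i j
    change f (X'.updateRow 0 (δ • X' 0) i j) = A.1 i j
    rw [Matrix.updateRow_apply]
    split_ifs with h
    · subst h
      rw [Pi.smul_apply, smul_eq_mul, map_mul, hfδ, one_mul]
      exact (hf _).trans (hev _ _)
    · exact (hf _).trans (hev _ _)

end GenericPoint

/-! ### The matrices `g_α d(A) g_α⁻¹` lie in the identity component -/

section Connected

variable {k K : Type u} [Field k] [Field K] [Algebra k K] [CharZero K] {α : K} {wα : Fin 7 → k}

/-- The residue field of the image point need not contain `K`, but it embeds into that of `P`, where
the matrix is visibly a conjugate of some `d(A)`; invertibility and the stabilizer equations descend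
along this injection. -/
theorem pointMap_mem_underlyingSpace (hα : α ≠ 0) (hw : ∀ i, algebraMap k K (wα i) = wVec α i)
    {S : Type u} [CommRing S] [Algebra k S] {ι : K →+* S}
    (hι : algebraMap k S = ι.comp (algebraMap k K)) (A : SL(3, S)) (P : PrimeSpectrum S) :
    pointMap (k := k) (conjBy α ι A) P ∈ underlyingSpace (k := k) (stabilizer wα) := by
  set p := pointMap (k := k) (conjBy α ι A) P
  let ev : MvPolynomial (Fin 7 × Fin 7) k →ₐ[k] S :=
    MvPolynomial.aeval fun ij : Fin 7 × Fin 7 => conjBy α ι A ij.1 ij.2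
  let j : p.asIdeal.ResidueField →+* P.asIdeal.ResidueField :=
    Ideal.ResidueField.map p.asIdeal P.asIdeal ev.toRingHom rfl
  let r : S →+* P.asIdeal.ResidueField := algebraMap S _
  have hj : ∀ x, j (algebraMap _ _ x) = r (ev x) := fun x =>
    Ideal.ResidueField.map_algebraMap _ _ _ _ x
  have hM : (matrixAt p).map j = conjBy α (r.comp ι) (Matrix.SpecialLinearGroup.map r A) := by
    rw [← conjBy_map]
    ext a b
    refine (hj _).trans ?_
    simp [ev, Matrix.mvPolynomialX]
  have hunit : IsUnit (matrixAt p) := by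
    rw [Matrix.isUnit_iff_isUnit_det, isUnit_iff_ne_zero]
    intro h0
    have h1 := congrArg j h0
    rw [map_zero, RingHom.map_det] at h1
    have h2 : (conjBy α (r.comp ι) (Matrix.SpecialLinearGroup.map r A)).det *
        (conjBy α (r.comp ι) (Matrix.SpecialLinearGroup.map r A)⁻¹).det = 1 := by
      rw [← Matrix.det_mul, ← conjBy_mul hα, mul_inv_cancel, conjBy_one hα, Matrix.det_one]
    rw [← hM] at h2
    rw [RingHom.mapMatrix_apply] at h1
    rw [h1, zero_mul] at h2
    exact zero_ne_one h2
  refine ⟨hunit.unit, mem_stabilizer_of_map_eq hα hw (f := j) (ι := r.comp ι) ?_ j.injective hM, rfl⟩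
  ext x
  rw [RingHom.comp_assoc, ← hι, RingHom.comp_apply, RingHom.comp_apply,
    IsScalarTower.algebraMap_apply k (MvPolynomial (Fin 7 × Fin 7) k) p.asIdeal.ResidueField, hj,
    MvPolynomial.algebraMap_eq, ← MvPolynomial.algebraMap_eq, AlgHom.commutes]

theorem mem_identityComponent_of_extend_eq (hα : α ≠ 0)
    (hw : ∀ i, algebraMap k K (wα i) = wVec α i) {R : Type u} [CommRing R] [Algebra k R]
    {g : GL (Fin 7) R} {A : SL(3, R ⊗[k] K)} (h : extend k K g = conjugate α A) :
    g ∈ identityComponent (stabilizer wα) R := by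
  have hf : (Algebra.TensorProduct.includeLeft : R →ₐ[k] R ⊗[k] K).toRingHom.comp
      (algebraMap k R) =
      (Algebra.TensorProduct.includeRight : K →ₐ[k] R ⊗[k] K).toRingHom.comp
        (algebraMap k K) := by
    ext x
    simp
  refine ⟨mem_stabilizer_of_map_eq hα hw hf (includeLeft_injective R) h, fun q => ?_⟩
  obtain ⟨A₀, hA₀⟩ := exists_generic_SL3 K
  have := isDomain_GL3Ring K
  let ι₀ : K →+* GL3Ring K := algebraMap K (GL3Ring K)
  -- The spectrum of a domain is irreducible, so its image `Z` is connected. It contains every point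
  -- of a conjugate of `d(B)` over a `K`-algebra, in particular the identity.
  let Z := Set.range (pointMap (k := k) (conjBy α ι₀ A₀))
  have hZ : IsPreconnected Z := isPreconnected_range (continuous_pointMap _)
  have hZU : Z ⊆ underlyingSpace (k := k) (stabilizer wα) := by
    rintro _ ⟨P, rfl⟩
    exact pointMap_mem_underlyingSpace hα hw (IsScalarTower.algebraMap_eq k K _) A₀ P
  have hspec : ∀ (L : Type u) [CommRing L] [Algebra k L] (ι : K →ₐ[k] L) (B : SL(3, L))
      (P : PrimeSpectrum L), pointMap (k := k) (conjBy α ι.toRingHom B) P ∈ Z := by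
    intro L _ _ ι B P
    let : Algebra K L := ι.toRingHom.toAlgebra
    have : IsScalarTower k K L := IsScalarTower.of_algebraMap_eq fun x => (ι.commutes x).symm
    obtain ⟨f, hfB⟩ := hA₀ L B
    refine ⟨PrimeSpectrum.comap (f.restrictScalars k).toRingHom P, ?_⟩
    rw [← pointMap_map]
    congr 1
    have h1 := conjBy_map f.toRingHom α ι₀ A₀
    rw [hfB, show f.toRingHom.comp ι₀ = ι.toRingHom from f.comp_algebraMap] at h1
    exact h1
  have hid : identityPoint k 7 ∈ Z := by
    have h1 := hspec K (AlgHom.id k K) 1 ⊥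
    rw [conjBy_one hα] at h1
    convert h1
    have h2 : (1 : Matrix (Fin 7) (Fin 7) K) =
        (1 : Matrix (Fin 7) (Fin 7) k).map (Algebra.ofId k K) := by simp
    rw [h2, pointMap_map, identityPoint]
    congr 1
    exact Subsingleton.elim _ _
  have hq : pointMap (k := k) (g : Matrix (Fin 7) (Fin 7) R) q ∈ Z := by
    -- Only over `R(α)` is `g` of the generic form, so `q` is first lifted to a prime there.
    obtain ⟨Q, rfl⟩ := PrimeSpectrum.comap_surjective_of_faithfullyFlat (A := R) (B := R ⊗[k] K) q
    have h1 := hspec (R ⊗[k] K) Algebra.TensorProduct.includeRight A Q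
    rw [← conjugate_eq_conjBy, ← h, extend, pointMap_map] at h1
    exact h1
  exact hZ.subset_connectedComponentIn hid hZU hq

end Connected

/-! ### The isomorphism and its naturality -/

section Isomorphism

variable {k K : Type u} [Field k] [Field K] [Algebra k K] [CharZero K] {α : K}

omit [CharZero K] in
theorem extend_map {R S : Type u} [CommRing R] [Algebra k R] [CommRing S] [Algebra k S]
    (f : R →ₐ[k] S) (g : GL (Fin 7) R) :
    extend k K (Matrix.GeneralLinearGroup.map (f : R →+* S) g) =
      (extend k K g).map (baseMap K f) := by
  ext i j
  simp [extend, baseMap]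

omit [CharZero K] in
theorem conjugate_map (σ : K ≃ₐ[k] K) {R S : Type u} [CommRing R] [Algebra k R] [CommRing S]
    [Algebra k S] (f : R →ₐ[k] S) (A : SU σ R) :
    conjugate α (SU.map σ f A : SL(3, S ⊗[k] K)) =
      (conjugate α (A : SL(3, R ⊗[k] K))).map (baseMap K f) := by
  have hι : (baseMap K f).toRingHom.comp
      (Algebra.TensorProduct.includeRight : K →ₐ[k] R ⊗[k] K).toRingHom =
      (Algebra.TensorProduct.includeRight : K →ₐ[k] S ⊗[k] K).toRingHom := by
    ext x
    simp [baseMap]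
  have h := conjBy_map (baseMap K f).toRingHom α
    (Algebra.TensorProduct.includeRight : K →ₐ[k] R ⊗[k] K).toRingHom A
  rw [hι] at h
  exact h.symm

/-- A multiplicative choice of matrices over `R` extending to `g_α d(A) g_α⁻¹`. -/
theorem exists_hom (hα : α ≠ 0) (hα2 : α ^ 2 ∈ Set.range (algebraMap k K))
    (hK : k⟮α⟯ = ⊤) {σ : K ≃ₐ[k] K} (hσα : σ α = -α) (R : Type u) [CommRing R] [Algebra k R] :
    ∃ ψ : SU σ R →* GL (Fin 7) R, ∀ A, extend k K (ψ A) = conjugate α A.1 := by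
  have : CharZero k := (algebraMap k K).charZero
  choose ψ hψ using fun A : SU σ R => exists_extend_eq hα hα2 hK hσα A.2
  refine ⟨MonoidHom.mk' ψ fun A B => extend_injective (k := k) (K := K) R ?_, hψ⟩
  rw [extend_mul, hψ, hψ, hψ]
  exact conjBy_mul hα _ _ _

end Isomorphism

end G2Prehomogeneous

theorem mainTheorem4 {k K : Type u} [Field k] [CharZero k] [Field K] [Algebra k K]
    (α : K) (hα : α ∉ Set.range (algebraMap k K)) (hα2 : α ^ 2 ∈ Set.range (algebraMap k K))
    (hK : k⟮α⟯ = ⊤) (σ : K ≃ₐ[k] K) (hσ : σ ≠ AlgEquiv.refl)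
    (wα : Fin 7 → k) (hw : ∀ i, algebraMap k K (wα i) = G2Prehomogeneous.wVec α i) :
    (∀ (R : Type u) [CommRing R] [Algebra k R],
      G2Prehomogeneous.identityComponent (G2Prehomogeneous.stabilizer wα) R =
        {g : GL (Fin 7) R | ∃ A ∈ G2Prehomogeneous.SU σ R,
          G2Prehomogeneous.extend k K g = G2Prehomogeneous.conjugate α A}) ∧
    ∃ H : ∀ (R : Type u) [CommRing R] [Algebra k R], Subgroup (GL (Fin 7) R),
      (∀ (R : Type u) [CommRing R] [Algebra k R],
        (H R : Set (GL (Fin 7) R)) =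
          G2Prehomogeneous.identityComponent (G2Prehomogeneous.stabilizer wα) R) ∧
      ∃ φ : ∀ (R : Type u) [CommRing R] [Algebra k R], G2Prehomogeneous.SU σ R ≃* H R,
        (∀ (R : Type u) [CommRing R] [Algebra k R] (A : G2Prehomogeneous.SU σ R),
          G2Prehomogeneous.extend k K (φ R A : GL (Fin 7) R) =
            G2Prehomogeneous.conjugate α (A : SL(3, R ⊗[k] K))) ∧
        ∀ (R S : Type u) [CommRing R] [Algebra k R] [CommRing S] [Algebra k S]
          (f : R →ₐ[k] S) (A : G2Prehomogeneous.SU σ R),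
          Matrix.GeneralLinearGroup.map (f : R →+* S) (φ R A : GL (Fin 7) R) =
            (φ S (G2Prehomogeneous.SU.map σ f A) : GL (Fin 7) S) := by
  open G2Prehomogeneous in
  have hα0 : α ≠ 0 := fun h => hα ⟨0, by rw [h, map_zero]⟩
  have : CharZero K := charZero_of_injective_algebraMap (algebraMap k K).injective
  have hσα := apply_eq_neg hα2 hK hσ
  have hcomp : ∀ (R : Type u) [CommRing R] [Algebra k R],
      identityComponent (stabilizer wα) R =
        {g : GL (Fin 7) R | ∃ A ∈ SU σ R, extend k K g = conjugate α A} := by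
    intro R _ _
    ext g
    constructor
    · intro hg
      obtain ⟨A, hA⟩ := exists_conjugate_of_mem_identityComponent hα0 hw hg
      exact ⟨A, mem_SU_of_extend_eq hα0 hσα hA, hA⟩
    · rintro ⟨A, -, hA⟩
      exact mem_identityComponent_of_extend_eq hα0 hw hA
  choose ψ hψ using fun (R : Type u) [CommRing R] [Algebra k R] =>
    exists_hom hα0 hα2 hK hσα R
  have hinj : ∀ (R : Type u) [CommRing R] [Algebra k R], Function.Injective (ψ R) := by
    intro R _ _ A B hAB
    apply Subtype.ext
    apply conjBy_injective hα0 (Algebra.TensorProduct.includeRight : K →ₐ[k] R ⊗[k] K).toRingHom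
    rw [← conjugate_eq_conjBy, ← conjugate_eq_conjBy, ← hψ, ← hψ, hAB]
  -- The subgroup structure on the identity component comes from its being the range of `ψ`.
  refine ⟨hcomp, fun R _ _ => (ψ R).range, fun R _ _ => ?_,
    fun R _ _ => MonoidHom.ofInjective (hinj R), fun R _ _ A => hψ R A,
    fun R S _ _ _ _ f A => extend_injective (k := k) (K := K) S ?_⟩
  · rw [hcomp]
    ext g
    constructor
    · rintro ⟨A, rfl⟩
      exact ⟨A.1, A.2, hψ R A⟩
    · rintro ⟨A, hA, h⟩
      exact ⟨⟨A, hA⟩, extend_injective (k := k) (K := K) R ((hψ R _).trans h.symm)⟩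
  · rw [extend_map]
    change (extend k K (ψ R A)).map _ = extend k K (ψ S _)
    rw [hψ, hψ, conjugate_map]
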